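/- **Proposition 3 (coded multicasting with caches and merging, PCS-M).** A server with a library of $M$ files of $F$ bits each is connected to $L\ge 1$ users by a shared error-free link of rate $R$ bits per second ($0<F,R<\infty$). User $j$ requests file $i$ at the times of a Poisson process of rate $\lambda_{ij}\ge 0$, with $\sum_{i,j}\lambda_{ij}>0$; these processes are independent. Each user has a cache of size $C$ files, $0\le C<M$, filled as in the Maddah-Ali–Niesen coded caching scheme; as only a part of each file is cached, all requests go to the server. The server keeps one FIFO queue for each user. A request for file $i$ from user $j$ that finds a request for file $i$ waiting in the queue of user $j$ merges with it; otherwise it joins the tail of that queue (also if the file is just being transmitted), and if it finds the system empty, its transmission starts at once. Whenever a transmission ends and some queue is non-empty, the head-of-the-line requests of all queues are removed and served together by one coded transmission (with dummy requests standing in for the empty queues), which takes the deterministic time $$ s=\frac{L(1-C/M)}{1+CL/M}\cdot\frac{F}{R}; $$ if all queues are empty, the server becomes idle. Let $D_k$ be the queuing delay of the $k$-th arrival to the server, that is, the time from its arrival until the start of the transmission that serves it. The state of the system consists of the contents of the queues and the residual time of the current transmission; its value at time $0$ may have any law, and is independent of the request processes. Then, for every initial law, $\{D_k\}$ is a (possibly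 delayed) aperiodic regenerative process with finite mean regeneration interval: there are random indices $S_0<S_1<\cdots$ such that, for each $n$, the process $(D_{S_n+k})_{k\ge0}$ together with $(S_{n+m+1}-S_{n+m})_{m\ge0}$ is independent of $S_0,\dots,S_n$ and $(D_k)_{k<S_n}$ and has a law that does not depend on $n$; the possible values of $S_1-S_0$ have greatest common divisor $1$; and $\mathbb{E}[S_1-S_0]<\infty$. Moreover, $\{D_k\}$ has a unique stationary distribution: there is exactly one probability measure $\pi$ on $\mathbb{R}$ such that, for some initial law of the system, $\{D_k\}$ is a stationary process with $D_k\sim\pi$ for all $k$. -/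

import Mathlib

open MeasureTheory ProbabilityTheory

/-! ## The system -/

/-- Parameters of the coded multicasting system: `L` users, `M` files of `fileSize` bits each, a
cache of `cacheSize` files at each user, a shared error-free link of `linkRate` bits per second, and
Poisson requests for file `i` at user `j` with rate `rate i j` (rate `0`: no such requests).
Every user stores only a part of each file, so `cacheSize < M` and no request is met locally. -/
structure PCSM where
  L : ℕ
  M : ℕ
  cacheSize : ℝ
  fileSize : ℝ
  linkRate : ℝ
  rate : Fin M → Fin L → ℝ
  L_pos : 0 < L
  cacheSize_nonneg : 0 ≤ cacheSize
  cacheSize_lt : cacheSize < M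
  fileSize_pos : 0 < fileSize
  linkRate_pos : 0 < linkRate
  rate_nonneg : ∀ i j, 0 ≤ rate i j
  exists_rate_pos : ∃ i j, 0 < rate i j

/-- A queue of distinct files, head first (requests for the same file are merged). -/
def FileQueue (M : ℕ) : Type := {l : List (Fin M) // l.Nodup}

/-- The finite set of queues carries the discrete σ-algebra. -/
instance (M : ℕ) : MeasurableSpace (FileQueue M) := ⊤

namespace FileQueue

variable {M : ℕ}

/-- Remove the head of the line (nothing happens to an empty queue). -/
def pop (q : FileQueue M) : FileQueue M := ⟨q.1.tail, q.2.tail⟩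

/-- A request for file `i` merges with a waiting request for `i` if there is one, and otherwise
joins the tail. -/
def join (q : FileQueue M) (i : Fin M) : FileQueue M :=
  if h : i ∈ q.1 then q else
    ⟨q.1 ++ [i], List.nodup_append.2 ⟨q.2, List.nodup_singleton i, fun a ha b hb hab =>
      h (by rw [List.mem_singleton] at hb; rwa [← hb, ← hab])⟩⟩

end FileQueue

namespace PCSM

variable (P : PCSM)

/-- The time one coded transmission takes: `L (1 - C/M) / (1 + C L/M)` file lengths are sent
over the link, whatever the head of the line requests are. -/
noncomputable def serviceTime : ℝ :=
  P.L * (1 - P.cacheSize / P.M) / (1 + P.cacheSize * P.L / P.M) * (P.fileSize / P.linkRate)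

/-- When `t = C L / M` is an integer, the service time is that of the Maddah-Ali–Niesen delivery:
each file is cut into one subfile for each `t`-set of users, and one coded packet of the size of a
subfile is sent for each `(t+1)`-set of users. -/
theorem serviceTime_eq_packets (t : ℕ) (ht : P.cacheSize * P.L = t * P.M) :
    P.serviceTime = ((Finset.univ : Finset (Fin P.L)).powersetCard (t + 1)).card *
      (P.fileSize / ((Finset.univ : Finset (Fin P.L)).powersetCard t).card) / P.linkRate := by
  have hL : (0 : ℝ) < P.L := by exact_mod_cast P.L_pos
  have hM : (0 : ℝ) < P.M := P.cacheSize_nonneg.trans_lt P.cacheSize_lt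
  have htL : t ≤ P.L := by
    have h : (t : ℝ) * P.M < P.L * P.M := by
      rw [← ht, mul_comm (P.L : ℝ)]; exact mul_lt_mul_of_pos_right P.cacheSize_lt hL
    exact_mod_cast (lt_of_mul_lt_mul_right h hM.le).le
  have hch : (0 : ℝ) < P.L.choose t := by exact_mod_cast Nat.choose_pos htL
  have key : (P.L.choose (t + 1) : ℝ) * (t + 1) = P.L.choose t * (P.L - t) := by
    have h := Nat.choose_succ_right_eq P.L t
    have h' : ((P.L.choose (t + 1) * (t + 1) : ℕ) : ℝ) = ((P.L.choose t * (P.L - t) : ℕ) : ℝ) := by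
      rw [h]
    push_cast [Nat.cast_sub htL] at h'
    exact h'
  have h1 : (1 : ℝ) + P.cacheSize * P.L / P.M = t + 1 := by
    rw [ht, mul_div_cancel_right₀ _ hM.ne']; ring
  have h2 : (P.L : ℝ) * (1 - P.cacheSize / P.M) = P.L - t := by
    have : (P.L : ℝ) * (P.cacheSize / P.M) = t := by
      rw [← mul_div_assoc, mul_comm, ht, mul_div_cancel_right₀ _ hM.ne']
    rw [mul_sub, this, mul_one]
  have ht1 : (0 : ℝ) < t + 1 := by positivity
  have hR := P.linkRate_pos.ne'
  rw [serviceTime, h1, h2, Finset.card_powersetCard, Finset.card_powersetCard, Finset.card_univ,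
    Fintype.card_fin]
  field_simp
  linear_combination -P.fileSize * key

/-! ## Dynamics of the queues at the server -/

/-- The state `(q, r)` of the server: `q j` is the queue of waiting requests of user `j`, and `r` is
the residual time of the transmission in progress (`r = 0`: the server is idle). Requests under
transmission have left the waiting queues, since an arriving request cannot merge with them. -/
abbrev State : Type := (Fin P.L → FileQueue P.M) × ℝ

/-- Admissible states: the residual time is in `[0, s]`, and nobody waits when the server is
idle. -/
def Admissible (x : P.State) : Prop :=
  0 ≤ x.2 ∧ x.2 ≤ P.serviceTime ∧ (x.2 = 0 → ∀ j, (x.1 j).1 = [])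

open Classical in
/-- The state after a time `t` without arrivals. When a transmission ends, the head of the line
requests of all queues go into the next transmission (with dummy requests for the empty queues),
unless all queues are empty, in which case the server becomes idle. -/
noncomputable def advance (q : Fin P.L → FileQueue P.M) (r t : ℝ) : P.State :=
  if t < r then (q, r - t)
  else if h : ∀ j, (q j).1 = [] then (q, 0)
  else advance (fun j => (q j).pop) P.serviceTime (t - r)
termination_by ∑ j, (q j).1.length
decreasing_by
  push Not at h
  obtain ⟨j, hj⟩ := h
  refine Finset.sum_lt_sum (fun i _ => ?_) ⟨j, Finset.mem_univ j, ?_⟩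
  · simp [FileQueue.pop]
  · have := List.length_pos_iff.2 hj
    simp only [FileQueue.pop, List.length_tail]
    omega

open Classical in
/-- The state just after the arrival of a request for file `i` from user `j`: an idle server starts
transmitting at once, otherwise the request joins (or merges into) the queue of user `j`. -/
noncomputable def arrive (x : P.State) (i : Fin P.M) (j : Fin P.L) : P.State :=
  if x.2 = 0 then (x.1, P.serviceTime)
  else (Function.update x.1 j ((x.1 j).join i), x.2)

open Classical in
/-- The queuing delay of a request for file `i` from user `j` that finds the state `x`, that is, the
time until the transmission that serves it begins. Transmissions start after the times
`r, r + s, r + 2 s, …` and each takes one request from every queue; `List.idxOf` is the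
number of requests ahead (the length of the queue if file `i` is not there). -/
noncomputable def delay (x : P.State) (i : Fin P.M) (j : Fin P.L) : ℝ :=
  if x.2 = 0 then 0 else x.2 + ((x.1 j).1.idxOf i : ℕ) * P.serviceTime

/-! ## Arrivals -/

/-- The request streams: pairs (file, user) with a positive rate. -/
abbrev Stream : Type := {e : Fin P.M × Fin P.L // 0 < P.rate e.1 e.2}

instance : Nonempty P.Stream :=
  let ⟨i, j, h⟩ := P.exists_rate_pos
  ⟨⟨(i, j), h⟩⟩

/-- The interarrival times of all streams: `τ (e, n)` is the time between the requests number `n - 1`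
and `n` of stream `e` (from time `0` when `n = 0`). -/
abbrev Clocks : Type := P.Stream × ℕ → ℝ

/-- The arrival time of the request number `n = 0, 1, 2, …` of stream `e`. -/
noncomputable def epoch (τ : P.Clocks) (e : P.Stream) (n : ℕ) : ℝ :=
  ∑ m ∈ Finset.range (n + 1), τ (e, m)

/-- An index with the smallest value. -/
noncomputable def argmin (f : P.Stream → ℝ) : P.Stream :=
  Set.Nonempty.some (s := {e | ∀ e', f e ≤ f e'}) (Finite.exists_min f)

open Classical in
/-- `counts τ k e` is the number of requests of stream `e` among the first `k` requests of
all streams together. -/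
noncomputable def counts (τ : P.Clocks) : ℕ → P.Stream → ℕ
  | 0 => fun _ => 0
  | k + 1 =>
    let e := P.argmin fun e => P.epoch τ e (counts τ k e)
    Function.update (counts τ k) e (counts τ k e + 1)

/-- The stream of the arrival number `k = 0, 1, 2, …` at the server. -/
noncomputable def arrivalStream (τ : P.Clocks) (k : ℕ) : P.Stream :=
  P.argmin fun e => P.epoch τ e (P.counts τ k e)

/-- The time of the arrival number `k` at the server. -/
noncomputable def arrivalTime (τ : P.Clocks) (k : ℕ) : ℝ :=
  P.epoch τ (P.arrivalStream τ k) (P.counts τ k (P.arrivalStream τ k))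

/-- The state just before the arrival number `k`, when the state at time `0` is `x₀`. -/
noncomputable def stateBefore (x₀ : P.State) (τ : P.Clocks) : ℕ → P.State
  | 0 => P.advance x₀.1 x₀.2 (P.arrivalTime τ 0)
  | k + 1 =>
    let e := P.arrivalStream τ k
    let x := P.arrive (stateBefore x₀ τ k) e.1.1 e.1.2
    P.advance x.1 x.2 (P.arrivalTime τ (k + 1) - P.arrivalTime τ k)

/-- The queuing delay `D k` of the arrival number `k`. -/
noncomputable def D (k : ℕ) (ω : P.State × P.Clocks) : ℝ :=
  P.delay (P.stateBefore ω.1 ω.2 k) (P.arrivalStream ω.2 k).1.1 (P.arrivalStream ω.2 k).1.2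

/-- The interarrival times of a Poisson process of rate `rate i j` are exponential. -/
noncomputable def interarrivalLaw (p : P.Stream × ℕ) : Measure ℝ :=
  expMeasure (P.rate p.1.1.1 p.1.1.2)

instance (p : P.Stream × ℕ) : IsProbabilityMeasure (P.interarrivalLaw p) :=
  isProbabilityMeasure_expMeasure p.1.2

/-- The law of the system with initial state distributed as `ν`: the streams are independent Poisson
processes (all interarrival times are independent), independent of the initial state. -/
noncomputable def law (ν : Measure P.State) : Measure (P.State × P.Clocks) :=
  ν.prod (Measure.infinitePi P.interarrivalLaw)

/-- `ν` is a probability law on the admissible states. -/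
def IsInitialLaw (ν : Measure P.State) : Prop :=
  IsProbabilityMeasure ν ∧ ∀ᵐ x ∂ν, P.Admissible x

end PCSM

/-! ## Regenerative and stationary processes in discrete time -/

section Regeneration

variable {Ω : Type*} [MeasurableSpace Ω] (μ : Measure Ω) (X : ℕ → Ω → ℝ)

/-- `X` is a (possibly delayed) regenerative process with regeneration epochs `S 0 < S 1 < …`: for
each `n`, what happens from `S n` on (the later cycle lengths and the shifted process) is
independent of the past (the epochs `S 0, …, S n` and the process before `S n`), and has a law that
does not depend on `n`. -/
structure IsRegenerative (S : ℕ → Ω → ℕ) : Prop where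
  measurable_process : ∀ k, Measurable (X k)
  measurable_epoch : ∀ n, Measurable (S n)
  strictMono : ∀ᵐ ω ∂μ, StrictMono fun n => S n ω
  indep : ∀ n, IndepFun
    (fun ω => ((fun m => S (n + m + 1) ω - S (n + m) ω, fun k => X (S n ω + k) ω) :
      (ℕ → ℕ) × (ℕ → ℝ)))
    (fun ω => ((fun i => S i ω, fun k => if k < S n ω then X k ω else 0) :
      (Fin (n + 1) → ℕ) × (ℕ → ℝ))) μ
  identDistrib : ∀ n, IdentDistrib
    (fun ω => ((fun m => S (n + m + 1) ω - S (n + m) ω, fun k => X (S n ω + k) ω) :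
      (ℕ → ℕ) × (ℕ → ℝ)))
    (fun ω => ((fun m => S (0 + m + 1) ω - S (0 + m) ω, fun k => X (S 0 ω + k) ω) :
      (ℕ → ℕ) × (ℕ → ℝ))) μ μ

/-- `X` is an aperiodic regenerative process with finite mean regeneration interval: the possible
lengths of a cycle have greatest common divisor `1`, and the mean length is finite. -/
def IsAperiodicRegenerative : Prop :=
  ∃ S : ℕ → Ω → ℕ, IsRegenerative μ X S ∧
    (∀ d : ℕ, (∀ m : ℕ, μ {ω | S 1 ω - S 0 ω = m} ≠ 0 → d ∣ m) → d = 1) ∧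
    Integrable (fun ω => (S 1 ω : ℝ) - (S 0 ω : ℝ)) μ

/-- `X` is (strictly) stationary: the shifted process has the same law. -/
def IsStrictlyStationary : Prop :=
  IdentDistrib (fun ω k => X (k + 1) ω) (fun ω k => X k ω) μ μ

end Regeneration

/-- `π` is a stationary distribution of the queuing delays: for some initial law of the
system, the delays form a stationary process and each of them has law `π`. -/
def PCSM.IsStationaryDistribution (P : PCSM) (π : Measure ℝ) : Prop :=
  ∃ ν, P.IsInitialLaw ν ∧ IsStrictlyStationary (P.law ν) P.D ∧ ∀ k, HasLaw (P.D k) π (P.law ν)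

/-!
The state just after an arrival is a random recursion: the next state is a function of the present
one and of the next pair (interarrival time, stream), and the queuing delay is another such function
(`PCSM.D_eq_output`). Two facts about this recursion give the theorem.

The pairs (interarrival time, stream) of the superposed Poisson processes are independent and
identically distributed. At the first arrival, won by stream `e` say, the clocks of the other streams
start afresh by memorylessness, and stream `e` has a fresh clock anyway
(`PCSM.clockLaw_race`). So the first pair is independent of the residual clocks, which have the
original law (`PCSM.map_mark_residual`), and the later arrivals are those of the residual clocks
(`PCSM.mark_residual`). The distribution of the pairs is never needed beyond the fact that
arbitrarily long interarrival times have positive probability.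

Since requests merge, a queue never holds more than `M` requests. Hence an interarrival time longer
than `M + 1` service times empties the system whatever its state was, the next request has delay `0`
and leaves the system in one fixed state (`PCSM.resetSystem`). These resets are independent events of
a fixed positive probability, so there are infinitely many of them, with geometric gaps. They serve
as regeneration epochs: the epochs and delays up to a reset are functions of the initial state and
the inputs up to it, and what follows is a fixed function of the later inputs
(`ResetSystem.measure_future_inter_past`). A cycle has length `1` with positive probability, whence
aperiodicity.

A stationary law for the recursion is the law of the state reached from a reset at a geometric time
in the past without a reset in between (`ResetSystem.map_next_stationary`). The law of the delay is
unique because two systems with the same inputs coincide after the first reset, so that the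
laws of their delays number `k` differ by at most a geometrically small amount
(`ResetSystem.measure_output_le`).
-/

/-! ### Memorylessness and infinite product measures -/

namespace ProbabilityTheory

theorem expMeasure_apply (r : ℝ) {A : Set ℝ} (hA : MeasurableSet A) :
    expMeasure r A = ∫⁻ x in A, exponentialPDF r x :=
  withDensity_apply _ hA

instance (r : ℝ) : NullSingletonClass (expMeasure r) :=
  inferInstanceAs (NullSingletonClass (volume.withDensity _))

theorem expMeasure_Iic_zero (r : ℝ) : expMeasure r (Set.Iic 0) = 0 := by
  rw [measure_congr Iio_ae_eq_Iic.symm, expMeasure_apply r measurableSet_Iio]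
  exact lintegral_exponentialPDF_of_nonpos le_rfl

theorem ae_expMeasure_pos (r : ℝ) : ∀ᵐ x ∂expMeasure r, 0 < x := by
  rw [ae_iff]
  simpa [Set.Iic] using expMeasure_Iic_zero r

theorem expMeasure_shift (r : ℝ) {t : ℝ} (ht : 0 ≤ t) {A : Set ℝ} (hA : MeasurableSet A) :
    expMeasure r {x | t < x ∧ x - t ∈ A} =
      ENNReal.ofReal (Real.exp (-(r * t))) * expMeasure r A := by
  have hS : MeasurableSet {x | t < x ∧ x - t ∈ A} :=
    measurableSet_Ioi.inter ((measurable_id.sub_const t) hA)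
  have hA' : expMeasure r A = expMeasure r (A ∩ Set.Ioi 0) := by
    refine measure_congr ?_
    filter_upwards [ae_expMeasure_pos r] with x hx
    exact propext ⟨fun h => ⟨h, hx⟩, fun h => h.1⟩
  rw [hA', expMeasure_apply r hS, expMeasure_apply r (hA.inter measurableSet_Ioi),
    ← lintegral_indicator hS, ← lintegral_indicator (hA.inter measurableSet_Ioi),
    ← lintegral_const_mul' _ _ ENNReal.ofReal_ne_top,
    ← lintegral_sub_right_eq_self
      (fun x => _ * (A ∩ Set.Ioi 0).indicator (exponentialPDF r) x) t]
  refine lintegral_congr fun x => ?_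
  by_cases hx : t < x ∧ x - t ∈ A
  · rw [Set.indicator_of_mem (s := {x | t < x ∧ x - t ∈ A}) hx,
      Set.indicator_of_mem (s := A ∩ Set.Ioi 0) ⟨hx.2, sub_pos.2 hx.1⟩,
      exponentialPDF_of_nonneg (ht.trans hx.1.le),
      exponentialPDF_of_nonneg (sub_nonneg.2 hx.1.le), ← ENNReal.ofReal_mul (Real.exp_pos _).le]
    congr 1
    rw [mul_left_comm, ← Real.exp_add]
    ring_nf
  · rw [Set.indicator_of_notMem (s := {x | t < x ∧ x - t ∈ A}) hx, Set.indicator_of_notMem,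
      mul_zero]
    exact fun h => hx ⟨sub_pos.1 h.2, h.1⟩

theorem expMeasure_Ioi {r : ℝ} (hr : 0 < r) {t : ℝ} (ht : 0 ≤ t) :
    expMeasure r (Set.Ioi t) = ENNReal.ofReal (Real.exp (-(r * t))) := by
  have := isProbabilityMeasure_expMeasure hr
  simpa [Set.Ioi] using expMeasure_shift r ht MeasurableSet.univ

/-- The exponential law is memoryless. -/
theorem expMeasure_memoryless {r : ℝ} (hr : 0 < r) {t : ℝ} (ht : 0 ≤ t) {A : Set ℝ}
    (hA : MeasurableSet A) :
    expMeasure r {x | t < x ∧ x - t ∈ A} = expMeasure r (Set.Ioi t) * expMeasure r A := by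
  rw [expMeasure_Ioi hr ht, expMeasure_shift r ht hA]

end ProbabilityTheory

namespace MeasureTheory.Measure

variable {I : Type*} (lam : I → Measure ℝ) [∀ i, IsProbabilityMeasure (lam i)]

/-- Inserting an independent coordinate at `i₀` into an infinite product and moving the other
coordinates along an injection `f` onto the complement of `i₀` that respects the marginals
gives the same infinite product. -/
theorem map_insert_infinitePi {i₀ : I} {f : I → I} (hf : f.Injective)
    (hrange : ∀ i, i ∈ Set.range f ↔ i ≠ i₀) (hlam : ∀ j, lam (f j) = lam j)
    {J : ℝ × (I → ℝ) → I → ℝ} (hJ : Measurable J) (hJ₀ : ∀ x, J x i₀ = x.1)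
    (hJf : ∀ x j, J x (f j) = x.2 j) :
    ((lam i₀).prod (infinitePi lam)).map J = infinitePi lam := by
  classical
  refine eq_infinitePi _ fun s t ht => ?_
  have hpre : J ⁻¹' Set.pi s t = (if i₀ ∈ s then t i₀ else Set.univ) ×ˢ
      Set.pi (s.preimage f hf.injOn : Finset I) (fun j => t (f j)) := by
    ext x
    simp only [Set.mem_preimage, Set.mem_pi, Finset.mem_coe, Set.mem_prod, Finset.mem_preimage]
    constructor
    · refine fun h => ⟨?_, fun j hj => hJf x j ▸ h _ hj⟩
      split_ifs with h0
      · exact hJ₀ x ▸ h _ h0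
      · trivial
    · rintro ⟨h0, h1⟩ i hi
      by_cases h : i = i₀
      · subst h
        rw [if_pos hi] at h0
        rwa [hJ₀]
      · obtain ⟨j, rfl⟩ := (hrange i).2 h
        rw [hJf]
        exact h1 j hi
  have hfilter : s.filter (· ∈ Set.range f) = s.erase i₀ := by
    ext i
    rw [Finset.mem_filter, hrange, Finset.mem_erase, and_comm]
  rw [map_apply hJ (.pi s.countable_toSet fun i _ => ht i), hpre, prod_prod,
    infinitePi_pi _ fun j _ => ht (f j)]
  rw [Finset.prod_congr rfl fun j _ => by rw [← hlam j],
    Finset.prod_preimage' f s hf.injOn (fun i => lam i (t i)), hfilter]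
  split_ifs with h0
  · exact Finset.mul_prod_erase s (fun i => lam i (t i)) h0
  · rw [measure_univ, one_mul, Finset.erase_eq_of_notMem h0]

/-- If the coordinates in `s₀` are memoryless at `t`, then given that they all exceed `t`, their
excesses over `t` and the other coordinates have the original joint law. -/
theorem infinitePi_excess {s₀ : Finset I} {t : ℝ}
    (hmem : ∀ i ∈ s₀, ∀ A, MeasurableSet A →
      lam i {x | t < x ∧ x - t ∈ A} = lam i (Set.Ioi t) * lam i A)
    (hpos : ∀ i ∈ s₀, lam i (Set.Ioi t) ≠ 0) {f : (I → ℝ) → I → ℝ} (hf : Measurable f)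
    (hf₀ : ∀ x, ∀ i ∈ s₀, f x i = x i - t) (hf₁ : ∀ x, ∀ i ∉ s₀, f x i = x i)
    {C : Set (I → ℝ)} (hC : MeasurableSet C) :
    infinitePi lam ({x | ∀ i ∈ s₀, t < x i} ∩ f ⁻¹' C) =
      (∏ i ∈ s₀, lam i (Set.Ioi t)) * infinitePi lam C := by
  classical
  set c := ∏ i ∈ s₀, lam i (Set.Ioi t)
  have hc0 : c ≠ 0 := Finset.prod_ne_zero_iff.2 hpos
  have hct : c ≠ ⊤ := ENNReal.prod_ne_top fun i _ => measure_ne_top _ _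
  have key : c⁻¹ • ((infinitePi lam).restrict {x | ∀ i ∈ s₀, t < x i}).map f = infinitePi lam := by
    refine eq_infinitePi _ fun s T hT => ?_
    set T₁ : I → Set ℝ := fun i => if i ∈ s then T i else Set.univ with hT₁
    have hT₁m : ∀ i, MeasurableSet (T₁ i) := fun i => by
      simp only [hT₁]; split_ifs; exacts [hT i, .univ]
    set T₂ : I → Set ℝ := fun i => if i ∈ s₀ then {x | t < x ∧ x - t ∈ T₁ i} else T₁ i with hT₂
    have hT₂m : ∀ i, MeasurableSet (T₂ i) := fun i => by
      simp only [hT₂]; split_ifs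
      exacts [measurableSet_Ioi.inter ((measurable_id.sub_const t) (hT₁m i)), hT₁m i]
    have hset : f ⁻¹' Set.pi s T ∩ {x | ∀ i ∈ s₀, t < x i} =
        Set.pi (s ∪ s₀ : Finset I) T₂ := by
      ext x
      simp only [Set.mem_inter_iff, Set.mem_preimage, Set.mem_pi, Finset.mem_coe,
        Set.mem_ofPred_eq, Finset.mem_union, hT₂, hT₁]
      constructor
      · rintro ⟨h1, h2⟩ i -
        by_cases h0 : i ∈ s₀ <;> by_cases hs : i ∈ s <;> simp only [h0, hs, if_true, if_false]
        · exact ⟨h2 i h0, hf₀ x i h0 ▸ h1 i hs⟩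
        · exact ⟨h2 i h0, trivial⟩
        · exact hf₁ x i h0 ▸ h1 i hs
        · trivial
      · refine fun h => ⟨fun i hs => ?_, fun i h0 => ?_⟩
        · have := h i (Or.inl hs)
          by_cases h0 : i ∈ s₀
          · simp only [h0, hs, if_true] at this
            exact hf₀ x i h0 ▸ this.2
          · simp only [h0, hs, if_true, if_false] at this
            exact hf₁ x i h0 ▸ this
        · have := h i (Or.inr h0)
          simp only [h0, if_true] at this
          exact this.1
    have hval : ∀ i, lam i (T₂ i) = (if i ∈ s₀ then lam i (Set.Ioi t) else 1) *
        (if i ∈ s then lam i (T i) else 1) := by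
      intro i
      have h1 : lam i (T₁ i) = if i ∈ s then lam i (T i) else 1 := by
        simp only [hT₁]; split_ifs <;> simp
      rw [← h1]
      simp only [hT₂]
      split_ifs with h0
      · exact hmem i h0 _ (hT₁m i)
      · rw [one_mul]
    rw [smul_apply, map_apply hf (.pi s.countable_toSet fun i _ => hT i),
      restrict_apply (hf (.pi s.countable_toSet fun i _ => hT i)), hset,
      infinitePi_pi _ fun i _ => hT₂m i, Finset.prod_congr rfl fun i _ => hval i,
      Finset.prod_mul_distrib, Finset.prod_ite_mem, Finset.prod_ite_mem,
      Finset.union_inter_cancel_right, Finset.union_inter_cancel_left, smul_eq_mul, ← mul_assoc,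
      ENNReal.inv_mul_cancel hc0 hct, one_mul]
  have hC' := congrArg (fun m : Measure (I → ℝ) => m C) key
  simp only [smul_apply, map_apply hf hC, restrict_apply (hf hC), smul_eq_mul] at hC'
  rw [← hC', ← mul_assoc, ENNReal.mul_inv_cancel hc0 hct, one_mul, Set.inter_comm]

end MeasureTheory.Measure

/-! ### Superposition of the request streams -/

namespace PCSM

variable (P : PCSM)

/-- The joint law of the interarrival times of all streams. -/
noncomputable abbrev clockLaw : Measure P.Clocks := Measure.infinitePi P.interarrivalLaw

theorem argmin_le (f : P.Stream → ℝ) (e : P.Stream) : f (P.argmin f) ≤ f e :=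
  Set.Nonempty.some_mem (s := {e | ∀ e', f e ≤ f e'}) (Finite.exists_min f) e

theorem argmin_congr {f g : P.Stream → ℝ} (h : ∀ e e', f e ≤ f e' ↔ g e ≤ g e') :
    P.argmin f = P.argmin g := by
  have : {e | ∀ e', f e ≤ f e'} = {e | ∀ e', g e ≤ g e'} :=
    Set.ext fun e => forall_congr' fun e' => h e e'
  unfold argmin
  congr 1

theorem argmin_const_add (c : ℝ) (f : P.Stream → ℝ) :
    P.argmin (fun e => c + f e) = P.argmin f :=
  P.argmin_congr fun _ _ => add_le_add_iff_left c

/-- The minimizer depends only on the order pattern, of which there are finitely many. -/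
theorem measurable_argmin : Measurable P.argmin := by
  classical
  let pat : (P.Stream → ℝ) → (P.Stream × P.Stream → Prop) := fun f p => f p.1 ≤ f p.2
  have hpat : Measurable pat := measurable_pi_iff.2 fun p =>
    measurableSet_setOfPred.1 (measurableSet_le (measurable_pi_apply p.1) (measurable_pi_apply p.2))
  refine measurable_to_countable' fun e => ?_
  have : P.argmin ⁻¹' {e} = pat ⁻¹' (pat '' (P.argmin ⁻¹' {e})) := by
    refine (Set.subset_preimage_image _ _).antisymm ?_
    rintro f ⟨g, hg, hgf⟩
    rw [Set.mem_preimage, Set.mem_singleton_iff] at hg ⊢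
    rw [← hg]
    exact P.argmin_congr fun a b => iff_of_eq (congrFun hgf (a, b)).symm
  rw [this]
  exact hpat (Set.toFinite _).measurableSet

/-- The stream of the first arrival. -/
noncomputable def firstStream (τ : P.Clocks) : P.Stream := P.argmin fun e => τ (e, 0)

open Classical in
/-- The interarrival times seen from the epoch of the first request of stream `e`, when all first
requests of the other streams are still to come. -/
noncomputable def residualAt (e : P.Stream) (τ : P.Clocks) : P.Clocks := fun p =>
  if p.1 = e then τ (e, p.2 + 1) else if p.2 = 0 then τ p - τ (e, 0) else τ p

/-- The interarrival times seen from the epoch of the first arrival. -/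
noncomputable def residual (τ : P.Clocks) : P.Clocks := P.residualAt (P.firstStream τ) τ

theorem measurable_firstStream : Measurable P.firstStream :=
  P.measurable_argmin.comp (measurable_pi_iff.2 fun _ => measurable_pi_apply _)

theorem measurable_residualAt (e : P.Stream) : Measurable (P.residualAt e) := by
  refine measurable_pi_iff.2 fun p => ?_
  unfold residualAt
  split_ifs <;> fun_prop

theorem measurable_residual : Measurable P.residual := by
  have : Measurable fun x : P.Clocks × P.Stream => P.residualAt x.2 x.1 :=
    measurable_from_prod_countable_left P.measurable_residualAt
  exact this.comp (measurable_id.prodMk P.measurable_firstStream)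

/-- The interarrival time (from time `0` when `k = 0`) and the stream of the arrival number `k`. -/
noncomputable def mark (τ : P.Clocks) : ℕ → ℝ × P.Stream
  | 0 => (P.arrivalTime τ 0, P.arrivalStream τ 0)
  | k + 1 => (P.arrivalTime τ (k + 1) - P.arrivalTime τ k, P.arrivalStream τ (k + 1))

theorem epoch_zero (τ : P.Clocks) (e : P.Stream) : P.epoch τ e 0 = τ (e, 0) := by
  simp [epoch]

theorem arrivalStream_zero (τ : P.Clocks) : P.arrivalStream τ 0 = P.firstStream τ := by
  simp [arrivalStream, counts, epoch_zero, firstStream]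

theorem mark_zero (τ : P.Clocks) : P.mark τ 0 = (τ (P.firstStream τ, 0), P.firstStream τ) := by
  simp [mark, arrivalTime, arrivalStream_zero, counts, epoch_zero]

open Classical in
theorem epoch_residual (τ : P.Clocks) (e : P.Stream) (n : ℕ) :
    P.epoch τ e (n + if e = P.firstStream τ then 1 else 0) =
      τ (P.firstStream τ, 0) + P.epoch (P.residual τ) e n := by
  unfold epoch residual residualAt
  by_cases h : e = P.firstStream τ
  · rw [if_pos h, Finset.sum_range_succ', add_comm]
    simp [← h]
  · simp only [h, if_false, add_zero]
    rw [Finset.sum_range_succ', Finset.sum_range_succ']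
    simp
    ring

open Classical in
theorem counts_residual (τ : P.Clocks) (k : ℕ) (e : P.Stream) :
    P.counts τ (k + 1) e =
      P.counts (P.residual τ) k e + if e = P.firstStream τ then 1 else 0 := by
  induction k generalizing e with
  | zero =>
    have h0 : P.argmin (fun e => P.epoch τ e (P.counts τ 0 e)) = P.firstStream τ :=
      P.arrivalStream_zero τ
    simp only [counts] at h0 ⊢
    rw [h0, Function.update_apply]
    simp
  | succ k ih =>
    have h1 : P.argmin (fun e => P.epoch τ e (P.counts τ (k + 1) e)) =
        P.argmin fun e => P.epoch (P.residual τ) e (P.counts (P.residual τ) k e) := by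
      rw [← P.argmin_const_add (τ (P.firstStream τ, 0))
        fun e => P.epoch (P.residual τ) e (P.counts (P.residual τ) k e)]
      simp_rw [ih, epoch_residual]
    have h2 : ∀ (τ : P.Clocks) (k : ℕ) (e : P.Stream), P.counts τ (k + 1) e =
        P.counts τ k e + if e = P.arrivalStream τ k then 1 else 0 := fun τ k e => by
      rw [counts]
      change Function.update (P.counts τ k) (P.arrivalStream τ k)
        (P.counts τ k (P.arrivalStream τ k) + 1) e = _
      rw [Function.update_apply]
      by_cases h : e = P.arrivalStream τ k
      · rw [if_pos h, if_pos h, ← h]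
      · rw [if_neg h, if_neg h, add_zero]
    rw [h2 τ, h2 (P.residual τ), ih, arrivalStream, h1, ← arrivalStream]
    ring

theorem arrivalStream_residual (τ : P.Clocks) (k : ℕ) :
    P.arrivalStream τ (k + 1) = P.arrivalStream (P.residual τ) k := by
  classical
  unfold arrivalStream
  rw [← P.argmin_const_add (τ (P.firstStream τ, 0))
    fun e => P.epoch (P.residual τ) e (P.counts (P.residual τ) k e)]
  simp_rw [counts_residual, epoch_residual]

theorem arrivalTime_residual (τ : P.Clocks) (k : ℕ) :
    P.arrivalTime τ (k + 1) = τ (P.firstStream τ, 0) + P.arrivalTime (P.residual τ) k := by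
  classical
  unfold arrivalTime
  rw [arrivalStream_residual, counts_residual, epoch_residual]

theorem mark_residual (τ : P.Clocks) (k : ℕ) : P.mark τ (k + 1) = P.mark (P.residual τ) k := by
  cases k with
  | zero =>
    have h0 : P.arrivalTime τ 0 = τ (P.firstStream τ, 0) := congrArg Prod.fst (P.mark_zero τ)
    simp [mark, arrivalTime_residual, arrivalStream_residual, h0]
  | succ k => simp [mark, arrivalTime_residual, arrivalStream_residual]

theorem measurable_mark_zero : Measurable fun τ => P.mark τ 0 := by
  simp_rw [mark_zero]
  have : Measurable fun x : P.Clocks × P.Stream => x.1 (x.2, 0) :=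
    measurable_from_prod_countable_left fun e => measurable_pi_apply (e, 0)
  exact (this.comp (measurable_id.prodMk P.measurable_firstStream)).prodMk P.measurable_firstStream

theorem measurable_mark : Measurable P.mark := by
  refine measurable_pi_iff.2 fun k => ?_
  induction k with
  | zero => exact P.measurable_mark_zero
  | succ k ih =>
    simp_rw [mark_residual]
    exact ih.comp P.measurable_residual

open Classical in
/-- The clocks whose first request of stream `e` comes after the time `x.1`, the later
interarrival times of `e` and all those of the other streams being as in `x.2`. -/
noncomputable def insertFirst (e : P.Stream) (x : ℝ × P.Clocks) : P.Clocks := fun p =>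
  if p.1 = e then (if p.2 = 0 then x.1 else x.2 (e, p.2 - 1)) else x.2 p

theorem measurable_insertFirst (e : P.Stream) : Measurable (P.insertFirst e) := by
  refine measurable_pi_iff.2 fun p => ?_
  unfold insertFirst
  split_ifs <;> fun_prop

theorem map_insertFirst (e : P.Stream) :
    ((P.interarrivalLaw (e, 0)).prod P.clockLaw).map (P.insertFirst e) = P.clockLaw := by
  classical
  refine Measure.map_insert_infinitePi P.interarrivalLaw (i₀ := (e, 0))
    (f := fun p => if p.1 = e then (e, p.2 + 1) else p) ?_ ?_ ?_ (P.measurable_insertFirst e) ?_ ?_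
  · rintro ⟨a, m⟩ ⟨b, n⟩ h
    dsimp only at h
    split_ifs at h with h1 h2 h2
    · simp_all
    · simp only [Prod.mk.injEq] at h
      exact absurd h.1.symm h2
    · simp only [Prod.mk.injEq] at h
      exact absurd h.1 h1
    · exact h
  · rintro ⟨a, m⟩
    constructor
    · rintro ⟨⟨b, n⟩, h⟩ h'
      rw [← h] at h'
      dsimp only at h'
      split_ifs at h' with h1
      · exact absurd (congrArg Prod.snd h') (Nat.succ_ne_zero n)
      · exact h1 (congrArg Prod.fst h')
    · intro h
      by_cases ha : a = e
      · subst ha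
        cases m with
        | zero => exact absurd rfl h
        | succ m => exact ⟨(a, m), by simp⟩
      · exact ⟨(a, m), by simp [ha]⟩
  · rintro ⟨a, m⟩
    by_cases ha : a = e <;> simp [ha, interarrivalLaw]
  · intro x
    simp [insertFirst]
  · rintro x ⟨a, m⟩
    by_cases ha : a = e <;> simp [ha, insertFirst]

/-- A race of exponential clocks won by stream `e`: the time of the win is independent of the
residual clocks, which have the original law. -/
theorem clockLaw_race (e : P.Stream) {B : Set ℝ} (hB : MeasurableSet B) {C : Set P.Clocks}
    (hC : MeasurableSet C) :
    P.clockLaw {τ | P.firstStream τ = e ∧ τ (e, 0) ∈ B ∧ P.residualAt e τ ∈ C} =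
      (∫⁻ t in B, ∏ i ∈ (Finset.univ.filter (· ≠ e)).map
          ⟨fun e' : P.Stream => (e', 0), fun _ _ h => (Prod.ext_iff.1 h).1⟩,
        P.interarrivalLaw i (Set.Ioi t) ∂P.interarrivalLaw (e, 0)) * P.clockLaw C := by
  classical
  set s₀ : Finset (P.Stream × ℕ) := (Finset.univ.filter (· ≠ e)).map
    ⟨fun e' : P.Stream => (e', 0), fun _ _ h => (Prod.ext_iff.1 h).1⟩ with hs₀
  have mem_s₀ : ∀ p, p ∈ s₀ ↔ p.1 ≠ e ∧ p.2 = 0 := by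
    rintro ⟨a, m⟩
    simp only [hs₀, Finset.mem_map, Finset.mem_filter_univ]
    constructor
    · rintro ⟨e', he', h⟩
      cases h
      exact ⟨he', rfl⟩
    · rintro ⟨ha, rfl⟩
      exact ⟨a, ha, rfl⟩
  have hE : MeasurableSet {τ | P.firstStream τ = e ∧ τ (e, 0) ∈ B ∧ P.residualAt e τ ∈ C} :=
    (P.measurable_firstStream (measurableSet_singleton e)).inter
      ((measurable_pi_apply (e, 0) hB).inter (P.measurable_residualAt e hC))
  have hE' := P.measurable_insertFirst e hE
  conv_lhs => rw [← P.map_insertFirst e]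
  rw [Measure.map_apply (P.measurable_insertFirst e) hE, Measure.prod_apply hE',
    ← lintegral_mul_const' _ _ (measure_ne_top _ _), ← lintegral_indicator hB]
  refine lintegral_congr_ae ?_
  filter_upwards [ae_expMeasure_pos (P.rate e.1.1 e.1.2)] with t ht
  by_cases htB : t ∈ B
  swap
  · rw [Set.indicator_of_notMem htB]
    convert measure_empty (μ := P.clockLaw)
    ext σ
    simp [insertFirst, htB]
  rw [Set.indicator_of_mem htB]
  set f : P.Clocks → P.Clocks := fun σ => P.residualAt e (P.insertFirst e (t, σ)) with hf
  have hfm : Measurable f := (P.measurable_residualAt e).comp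
    ((P.measurable_insertFirst e).comp measurable_prodMk_left)
  rw [← Measure.infinitePi_excess P.interarrivalLaw (s₀ := s₀) (t := t) (f := f) _ _ hfm _ _ hC]
  · refine measure_congr ?_
    have hne : ∀ᵐ σ ∂P.clockLaw, ∀ e' : P.Stream, σ (e', 0) ≠ t := by
      rw [ae_all_iff]
      intro e'
      have := (measurePreserving_eval_infinitePi P.interarrivalLaw (e', 0)).quasiMeasurePreserving.ae
        (p := fun x => x ≠ t)
      refine this ?_
      rw [ae_iff]
      simp [interarrivalLaw]
    filter_upwards [hne] with σ hσ
    refine propext ?_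
    change (P.firstStream (P.insertFirst e (t, σ)) = e ∧ P.insertFirst e (t, σ) (e, 0) ∈ B ∧
      f σ ∈ C) ↔ (∀ i ∈ s₀, t < σ i) ∧ f σ ∈ C
    have h0 : P.insertFirst e (t, σ) (e, 0) = t := by simp [insertFirst]
    have h1 : ∀ e' ≠ e, P.insertFirst e (t, σ) (e', 0) = σ (e', 0) := fun e' he' => by
      simp [insertFirst, he']
    rw [h0]
    refine ⟨fun h => ⟨?_, h.2.2⟩, fun h => ⟨?_, htB, h.2⟩⟩
    · rintro ⟨e', m⟩ hi
      obtain ⟨he', rfl⟩ := (mem_s₀ _).1 hi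
      have := P.argmin_le (fun e' => P.insertFirst e (t, σ) (e', 0)) e'
      change P.insertFirst e (t, σ) (P.firstStream (P.insertFirst e (t, σ)), 0) ≤ _ at this
      rw [h.1, h0, h1 e' he'] at this
      exact lt_of_le_of_ne this (hσ e').symm
    · by_contra hne
      have := P.argmin_le (fun e' => P.insertFirst e (t, σ) (e', 0)) e
      change P.insertFirst e (t, σ) (P.firstStream (P.insertFirst e (t, σ)), 0) ≤ _ at this
      rw [h0, h1 _ hne] at this
      exact this.not_gt (h.1 _ ((mem_s₀ _).2 ⟨hne, rfl⟩))
  · intro i _ A hA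
    exact expMeasure_memoryless i.1.2 ht.le hA
  · intro i _
    rw [interarrivalLaw, expMeasure_Ioi i.1.2 ht.le]
    simp [Real.exp_pos]
  · intro x i hi
    obtain ⟨h1, h2⟩ := (mem_s₀ _).1 hi
    simp [hf, residualAt, insertFirst, h1, h2]
  · rintro x ⟨a, m⟩ hi
    have := mt (mem_s₀ (a, m)).2 hi
    by_cases ha : a = e
    · simp [hf, residualAt, insertFirst, ha]
    · have hm : m ≠ 0 := fun hm => this ⟨ha, hm⟩
      simp [hf, residualAt, insertFirst, ha, hm]

/-- The law of an interarrival time and its stream in the superposition. -/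
noncomputable def markLaw : Measure (ℝ × P.Stream) := P.clockLaw.map fun τ => P.mark τ 0

instance : IsProbabilityMeasure P.markLaw :=
  Measure.isProbabilityMeasure_map P.measurable_mark_zero.aemeasurable

/-- The first arrival is independent of the residual clocks, which have the original law. -/
theorem map_mark_residual :
    P.clockLaw.map (fun τ => (P.mark τ 0, P.residual τ)) = P.markLaw.prod P.clockLaw := by
  have hm : Measurable fun τ => (P.mark τ 0, P.residual τ) :=
    P.measurable_mark_zero.prodMk P.measurable_residual
  refine (Measure.prod_eq fun W C hW hC => ?_).symm
  rw [Measure.map_apply hm (hW.prod hC), markLaw, Measure.map_apply P.measurable_mark_zero hW]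
  have split : ∀ C : Set P.Clocks, MeasurableSet C →
      P.clockLaw ((fun τ => (P.mark τ 0, P.residual τ)) ⁻¹' W ×ˢ C) =
      ∑ e, P.clockLaw {τ | P.firstStream τ = e ∧ τ (e, 0) ∈ {t | (t, e) ∈ W} ∧
        P.residualAt e τ ∈ C} := by
    intro C hC
    have hA := hm (hW.prod hC)
    set A := (fun τ => (P.mark τ 0, P.residual τ)) ⁻¹' W ×ˢ C with hAdef
    have h := sum_measure_preimage_singleton (μ := P.clockLaw.restrict A) Finset.univ
      (f := P.firstStream) fun e _ => P.measurable_firstStream (measurableSet_singleton e)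
    rw [Finset.coe_univ, Set.preimage_univ, Measure.restrict_apply_univ] at h
    rw [← h]
    refine Finset.sum_congr rfl fun e _ => ?_
    rw [Measure.restrict_apply (P.measurable_firstStream (measurableSet_singleton e))]
    congr 1
    ext τ
    simp only [hAdef, Set.mem_inter_iff, Set.mem_preimage, Set.mem_singleton_iff, Set.mem_prod,
      Set.mem_ofPred_eq, mark_zero, residual]
    constructor
    · rintro ⟨rfl, h⟩
      exact ⟨rfl, h⟩
    · rintro ⟨rfl, h⟩
      exact ⟨rfl, h⟩
  have hW' : (fun τ => P.mark τ 0) ⁻¹' W =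
      (fun τ => (P.mark τ 0, P.residual τ)) ⁻¹' W ×ˢ Set.univ := by
    ext τ
    simp
  rw [hW', split C hC, split _ .univ, Finset.sum_mul]
  refine Finset.sum_congr rfl fun e _ => ?_
  have hB : MeasurableSet {t : ℝ | (t, e) ∈ W} := measurable_prodMk_right hW
  rw [P.clockLaw_race e hB hC, P.clockLaw_race e hB .univ, measure_univ, mul_one]

/-- The law of the sequence of arrivals. -/
noncomputable def marksLaw : Measure (ℕ → ℝ × P.Stream) := P.clockLaw.map P.mark

instance : IsProbabilityMeasure P.marksLaw :=
  Measure.isProbabilityMeasure_map P.measurable_mark.aemeasurable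

theorem map_marksLaw :
    P.marksLaw.map (fun x => (x 0, fun k => x (k + 1))) = P.markLaw.prod P.marksLaw := by
  rw [marksLaw, Measure.map_map (by fun_prop) P.measurable_mark]
  have : (fun x : ℕ → ℝ × P.Stream => (x 0, fun k => x (k + 1))) ∘ P.mark =
      Prod.map id P.mark ∘ fun τ => (P.mark τ 0, P.residual τ) := by
    funext τ
    simp [mark_residual]
  rw [this, ← Measure.map_map (measurable_id.prodMap P.measurable_mark)
    (P.measurable_mark_zero.prodMk P.measurable_residual), map_mark_residual,
    ← Measure.map_prod_map _ _ measurable_id P.measurable_mark, Measure.map_id]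

theorem ae_markLaw_nonneg : ∀ᵐ y ∂P.markLaw, 0 ≤ y.1 := by
  rw [markLaw, ae_map_iff P.measurable_mark_zero.aemeasurable
    (measurableSet_le measurable_const measurable_fst)]
  have : ∀ᵐ τ ∂P.clockLaw, ∀ e : P.Stream, 0 < τ (e, 0) := by
    rw [ae_all_iff]
    intro e
    exact (measurePreserving_eval_infinitePi P.interarrivalLaw (e, 0)).quasiMeasurePreserving.ae
      (ae_expMeasure_pos (P.rate e.1.1 e.1.2))
  filter_upwards [this] with τ hτ
  rw [mark_zero]
  exact (hτ _).le

/-- Arbitrarily long interarrival times have positive probability. -/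
theorem markLaw_gt_ne_zero {c : ℝ} (hc : 0 ≤ c) : P.markLaw {y | c < y.1} ≠ 0 := by
  classical
  rw [markLaw, Measure.map_apply P.measurable_mark_zero
    (measurableSet_lt measurable_const measurable_fst)]
  let s : Finset (P.Stream × ℕ) := Finset.univ.map
    ⟨fun e : P.Stream => (e, 0), fun _ _ h => (Prod.ext_iff.1 h).1⟩
  have hs : P.clockLaw (Set.pi s fun _ => Set.Ioi c) ≠ 0 := by
    rw [Measure.infinitePi_pi _ fun _ _ => measurableSet_Ioi]
    refine Finset.prod_ne_zero_iff.2 fun i _ => ?_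
    rw [interarrivalLaw, expMeasure_Ioi i.1.2 hc]
    simp [Real.exp_pos]
  refine fun h => hs (measure_mono_null (fun τ hτ => ?_) h)
  change c < (P.mark τ 0).1
  rw [mark_zero]
  exact hτ (P.firstStream τ, 0) (Finset.mem_map_of_mem _ (Finset.mem_univ _))

end PCSM

/-! ### Independent and identically distributed sequences -/

section IID

variable {𝒴 : Type*}

/-- `Q` is the law of a sequence of independent random variables with law `κ`, expressed by the
self-similarity of `Q`: the first term has law `κ` and is independent of the remaining terms, which
again have the joint law `Q`. -/
structure IsIIDLaw [MeasurableSpace 𝒴] (κ : Measure 𝒴) (Q : Measure (ℕ → 𝒴)) : Prop where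
  isProbabilityMeasure : IsProbabilityMeasure Q
  map_head_tail : Q.map (fun x => (x 0, fun k => x (k + 1))) = κ.prod Q

/-- The terms from number `m` on. -/
def seqDrop (m : ℕ) (x : ℕ → 𝒴) : ℕ → 𝒴 := fun k => x (m + k)

/-- The sequence that stops moving at the term number `m`; it carries the information in the
terms up to number `m`. -/
def seqFreeze (m : ℕ) (x : ℕ → 𝒴) : ℕ → 𝒴 := fun k => x (min k m)

theorem measurable_seqDrop [MeasurableSpace 𝒴] (m : ℕ) :
    Measurable (seqDrop m : (ℕ → 𝒴) → ℕ → 𝒴) :=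
  measurable_pi_iff.2 fun _ => measurable_pi_apply _

theorem measurable_seqFreeze [MeasurableSpace 𝒴] (m : ℕ) :
    Measurable (seqFreeze m : (ℕ → 𝒴) → ℕ → 𝒴) :=
  measurable_pi_iff.2 fun _ => measurable_pi_apply _

theorem seqFreeze_apply {m k : ℕ} (h : k ≤ m) (x : ℕ → 𝒴) : seqFreeze m x k = x k := by
  rw [seqFreeze, min_eq_left h]

namespace IsIIDLaw

variable [MeasurableSpace 𝒴] {κ : Measure 𝒴} {Q : Measure (ℕ → 𝒴)}

theorem measurePreserving_head_tail (hQ : IsIIDLaw κ Q) :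
    MeasurePreserving (fun x : ℕ → 𝒴 => (x 0, fun k => x (k + 1))) Q (κ.prod Q) :=
  ⟨by fun_prop, hQ.map_head_tail⟩

theorem measure_forall_lt (hQ : IsIIDLaw κ Q) {A : Set 𝒴} (hA : MeasurableSet A) (n : ℕ) :
    Q {x | ∀ k < n, x k ∈ A} = κ A ^ n := by
  have := hQ.isProbabilityMeasure
  induction n with
  | zero => simp
  | succ n ih =>
    have hm : MeasurableSet {x : ℕ → 𝒴 | ∀ k < n, x k ∈ A} := by
      simp only [Set.ofPred_forall]
      exact .iInter fun k => .iInter fun _ => measurable_pi_apply k hA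
    have : {x : ℕ → 𝒴 | ∀ k < n + 1, x k ∈ A} =
        (fun x : ℕ → 𝒴 => (x 0, fun k => x (k + 1))) ⁻¹' (A ×ˢ {x | ∀ k < n, x k ∈ A}) := by
      ext x
      constructor
      · exact fun h => ⟨h 0 n.succ_pos, fun k hk => h (k + 1) (Nat.succ_lt_succ hk)⟩
      · rintro ⟨h0, h1⟩ (_ | k) hk
        exacts [h0, h1 k (Nat.lt_of_succ_lt_succ hk)]
    rw [this, hQ.measurePreserving_head_tail.measure_preimage (hA.prod hm).nullMeasurableSet,
      Measure.prod_prod, ih, pow_succ']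

variable [IsProbabilityMeasure κ]

theorem measurePreserving_seqDrop (hQ : IsIIDLaw κ Q) (m : ℕ) :
    MeasurePreserving (seqDrop m) Q Q := by
  have := hQ.isProbabilityMeasure
  induction m with
  | zero =>
    convert MeasurePreserving.id Q using 1
    funext x k
    simp [seqDrop]
  | succ m ih =>
    have h := (measurePreserving_snd.comp hQ.measurePreserving_head_tail).comp ih
    convert h using 1
    funext x k
    change x (m + 1 + k) = x (m + (k + 1))
    congr 1; omega

theorem measurePreserving_eval (hQ : IsIIDLaw κ Q) (k : ℕ) :
    MeasurePreserving (fun x : ℕ → 𝒴 => x k) Q κ := by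
  have := hQ.isProbabilityMeasure
  exact (measurePreserving_fst.comp hQ.measurePreserving_head_tail).comp
    (hQ.measurePreserving_seqDrop k)

theorem ae_forall (hQ : IsIIDLaw κ Q) {p : 𝒴 → Prop} (hp : ∀ᵐ y ∂κ, p y) :
    ∀ᵐ x ∂Q, ∀ k, p (x k) :=
  ae_all_iff.2 fun k => (hQ.measurePreserving_eval k).quasiMeasurePreserving.ae hp

/-- The terms up to number `m` are independent of the later ones. -/
theorem map_freeze_drop (hQ : IsIIDLaw κ Q) (m : ℕ) :
    Q.map (fun x => (seqFreeze m x, seqDrop (m + 1) x)) = (Q.map (seqFreeze m)).prod Q := by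
  have := hQ.isProbabilityMeasure
  suffices h : ∃ ζ : Measure (ℕ → 𝒴), IsProbabilityMeasure ζ ∧
      MeasurePreserving (fun x => (seqFreeze m x, seqDrop (m + 1) x)) Q (ζ.prod Q) by
    obtain ⟨ζ, hζ, h⟩ := h
    have h1 : Q.map (seqFreeze m) = ζ := (measurePreserving_fst.comp h).map_eq
    rw [h1, h.map_eq]
  induction m with
  | zero =>
    have hc : Measurable fun (y : 𝒴) (_ : ℕ) => y := by fun_prop
    refine ⟨κ.map fun y _ => y, Measure.isProbabilityMeasure_map hc.aemeasurable, ?_⟩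
    have h := ((hc.measurePreserving κ).prod (MeasurePreserving.id Q)).comp
      hQ.measurePreserving_head_tail
    convert h using 1
    funext x
    refine Prod.ext (funext fun k => ?_) (funext fun k => ?_)
    · simp [seqFreeze]
    · simp [seqDrop, add_comm]
  | succ m ih =>
    obtain ⟨ζ, hζ, h⟩ := ih
    have hF : Measurable fun (p : (ℕ → 𝒴) × 𝒴) (k : ℕ) => if k ≤ m then p.1 k else p.2 := by
      refine measurable_pi_iff.2 fun k => ?_
      split_ifs <;> fun_prop
    refine ⟨(ζ.prod κ).map _, Measure.isProbabilityMeasure_map hF.aemeasurable, ?_⟩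
    have h' := ((hF.measurePreserving (ζ.prod κ)).prod (MeasurePreserving.id Q)).comp
      (((measurePreserving_prodAssoc ζ κ Q).symm).comp
        (((MeasurePreserving.id ζ).prod hQ.measurePreserving_head_tail).comp h))
    convert h' using 1
    funext x
    refine Prod.ext (funext fun k => ?_) (funext fun k => ?_)
    · change x (min k (m + 1)) = if k ≤ m then x (min k m) else x (m + 1 + 0)
      split_ifs with hk
      · congr 1; omega
      · congr 1; omega
    · change x (m + 1 + 1 + k) = x (m + 1 + (k + 1))
      congr 1; omega

theorem compl_lt_one {A : Set 𝒴} (hA : MeasurableSet A) (h0 : κ A ≠ 0) : κ Aᶜ < 1 := by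
  rw [prob_compl_eq_one_sub hA]
  exact ENNReal.sub_lt_self ENNReal.one_ne_top one_ne_zero h0

theorem ae_infinite (hQ : IsIIDLaw κ Q) {A : Set 𝒴} (hA : MeasurableSet A) (h0 : κ A ≠ 0) :
    ∀ᵐ x ∂Q, {k | x k ∈ A}.Infinite := by
  have hnull : Q {x | ∀ k, x k ∈ Aᶜ} = 0 := by
    refine le_antisymm ?_ zero_le
    refine ge_of_tendsto' (ENNReal.tendsto_pow_atTop_nhds_zero_of_lt_one (compl_lt_one hA h0))
      fun n => ?_
    rw [← hQ.measure_forall_lt hA.compl n]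
    exact measure_mono fun x hx k _ => hx k
  have hae : ∀ᵐ x ∂Q, ∃ k, x k ∈ A := by
    rw [ae_iff]
    simpa using hnull
  have : ∀ᵐ x ∂Q, ∀ m, ∃ k, seqDrop m x k ∈ A :=
    ae_all_iff.2 fun m => (hQ.measurePreserving_seqDrop m).quasiMeasurePreserving.ae hae
  filter_upwards [this] with x hx
  rw [← Nat.frequently_atTop_iff_infinite, Filter.frequently_atTop]
  intro m
  obtain ⟨k, hk⟩ := hx m
  exact ⟨m + k, Nat.le_add_right m k, hk⟩

end IsIIDLaw

end IID

/-! ### Successive visits of a sequence to a set -/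

section Visits

variable {𝒴 : Type*}

/-- The index of the visit number `n = 0, 1, 2, …` of the sequence `x` to the set `G`, and `0` if
there are fewer visits. -/
noncomputable def visit (G : Set 𝒴) (x : ℕ → 𝒴) (n : ℕ) : ℕ := Nat.nth (fun k => x k ∈ G) n

variable {G : Set 𝒴}

open Classical in
theorem visit_eq_of_count {x : ℕ → 𝒴} {m : ℕ} (h : x m ∈ G) :
    visit G x (Nat.count (fun k => x k ∈ G) m) = m :=
  Nat.nth_count (p := fun k => x k ∈ G) h

open Classical in
theorem visit_eq_iff {x : ℕ → 𝒴} (hx : {k | x k ∈ G}.Infinite) {n m : ℕ} :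
    visit G x n = m ↔ x m ∈ G ∧ Nat.count (fun k => x k ∈ G) m = n := by
  constructor
  · rintro rfl
    exact ⟨Nat.nth_mem_of_infinite hx n, Nat.count_nth_of_infinite hx n⟩
  · rintro ⟨h, rfl⟩
    exact visit_eq_of_count h

open Classical in
theorem measurable_count_visits [MeasurableSpace 𝒴] (hG : MeasurableSet G) (m : ℕ) :
    Measurable fun x : ℕ → 𝒴 => Nat.count (fun k => x k ∈ G) m := by
  induction m with
  | zero => simp
  | succ m ih =>
    simp_rw [Nat.count_succ]
    exact ih.add (Measurable.ite (measurable_pi_apply m hG) measurable_const measurable_const)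

theorem measurable_visit [MeasurableSpace 𝒴] (hG : MeasurableSet G) (n : ℕ) :
    Measurable fun x : ℕ → 𝒴 => visit G x n := by
  classical
  have key : ∀ m, m ≠ 0 → MeasurableSet {x : ℕ → 𝒴 | visit G x n = m} := by
    intro m hm
    have : {x : ℕ → 𝒴 | visit G x n = m} =
        {x | x m ∈ G} ∩ {x | Nat.count (fun k => x k ∈ G) m = n} := by
      ext x
      constructor
      · rintro rfl
        -- a nonzero value of `Nat.nth` cannot be the default value for a missing visit
        have hn : ∀ hf : (Set.ofPred fun k => x k ∈ G).Finite, n < hf.toFinset.card := by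
          intro hf
          by_contra hlt
          exact hm (Nat.nth_of_card_le hf (not_lt.1 hlt))
        exact ⟨Nat.nth_mem n hn, Nat.count_nth hn⟩
      · rintro ⟨h, rfl⟩
        exact visit_eq_of_count h
    rw [this]
    exact (measurable_pi_apply m hG).inter
      (measurable_count_visits hG m (measurableSet_singleton n))
  refine measurable_to_countable' fun m => ?_
  by_cases hm : m = 0
  · have : (fun x : ℕ → 𝒴 => visit G x n) ⁻¹' {m} =
        (⋃ j : ℕ, {x : ℕ → 𝒴 | visit G x n = j + 1})ᶜ := by
      ext x
      simp only [Set.mem_preimage, Set.mem_singleton_iff, Set.mem_compl_iff, Set.mem_iUnion,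
        Set.mem_ofPred_eq, hm]
      exact ⟨fun h ⟨j, hj⟩ => by omega, fun h => by
        by_contra h0
        exact h ⟨visit G x n - 1, by omega⟩⟩
    rw [this]
    exact (MeasurableSet.iUnion fun j => key (j + 1) j.succ_ne_zero).compl
  · exact key m hm

theorem visit_strictMono {x : ℕ → 𝒴} (hx : {k | x k ∈ G}.Infinite) : StrictMono (visit G x) :=
  Nat.nth_strictMono hx

theorem infinite_seqDrop {x : ℕ → 𝒴} (hx : {k | x k ∈ G}.Infinite) (m : ℕ) :
    {k | seqDrop m x k ∈ G}.Infinite := by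
  rw [← Nat.frequently_atTop_iff_infinite, Filter.frequently_atTop] at hx ⊢
  intro a
  obtain ⟨b, hb, hbG⟩ := hx (m + a)
  refine ⟨b - m, by omega, ?_⟩
  rw [seqDrop, Nat.add_sub_cancel' (by omega)]
  exact hbG

/-- The visits after the visit number `n` are those of the sequence after that visit. -/
theorem visit_add {x : ℕ → 𝒴} (hx : {k | x k ∈ G}.Infinite) (n j : ℕ) :
    visit G x (n + 1 + j) =
      visit G x n + 1 + visit G (seqDrop (visit G x n + 1) x) j := by
  classical
  obtain ⟨hm, hc⟩ := (visit_eq_iff hx (n := n)).1 rfl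
  obtain ⟨hv, hd⟩ := (visit_eq_iff (infinite_seqDrop hx (visit G x n + 1)) (n := j)).1 rfl
  refine (visit_eq_iff hx).2 ⟨hv, ?_⟩
  rw [Nat.count_add, Nat.count_succ, hc, if_pos hm]
  exact congrArg (n + 1 + ·) hd

open Classical in
theorem count_seqFreeze {x : ℕ → 𝒴} {m k : ℕ} (h : k ≤ m + 1) :
    Nat.count (fun i => seqFreeze m x i ∈ G) k = Nat.count (fun i => x i ∈ G) k := by
  induction k with
  | zero => simp
  | succ k ih => rw [Nat.count_succ, Nat.count_succ, ih (by omega), seqFreeze_apply (by omega)]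

theorem visit_seqFreeze {x : ℕ → 𝒴} (hx : {k | x k ∈ G}.Infinite) {i m : ℕ}
    (h : visit G x i ≤ m) : visit G (seqFreeze m x) i = visit G x i := by
  classical
  obtain ⟨hv, hc⟩ := (visit_eq_iff hx (n := i)).1 rfl
  rw [← seqFreeze_apply h x] at hv
  have := visit_eq_of_count hv
  rwa [count_seqFreeze (by omega), hc] at this

theorem not_mem_of_lt_visit_zero {x : ℕ → 𝒴} {k : ℕ} (h : k < visit G x 0) : x k ∉ G := by
  rw [visit, Nat.nth_zero] at h
  exact Nat.notMem_of_lt_sInf h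

theorem lintegral_visit_zero_ne_top [MeasurableSpace 𝒴] {κ : Measure 𝒴} [IsProbabilityMeasure κ]
    {Q : Measure (ℕ → 𝒴)} (hQ : IsIIDLaw κ Q) (hG : MeasurableSet G) (h0 : κ G ≠ 0) :
    ∫⁻ x, (visit G x 0 : ENNReal) ∂Q ≠ ⊤ := by
  have hA : ∀ k : ℕ, MeasurableSet {x : ℕ → 𝒴 | ∀ j < k + 1, x j ∈ Gᶜ} := fun k => by
    simp only [Set.ofPred_forall]
    exact .iInter fun k => .iInter fun _ => measurable_pi_apply k hG.compl
  have hle : ∀ x : ℕ → 𝒴, (visit G x 0 : ENNReal) ≤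
      ∑' k : ℕ, {x : ℕ → 𝒴 | ∀ j < k + 1, x j ∈ Gᶜ}.indicator 1 x := by
    intro x
    refine le_trans ?_ (ENNReal.sum_le_tsum (Finset.range (visit G x 0)))
    rw [Finset.sum_congr rfl (g := fun _ => 1)]
    · simp
    · intro k hk
      rw [Set.indicator_of_mem]
      · rfl
      · exact fun j hj => not_mem_of_lt_visit_zero (by have := Finset.mem_range.1 hk; omega)
  refine ne_top_of_le_ne_top ?_ (lintegral_mono hle)
  rw [lintegral_tsum fun k => (measurable_one.indicator (hA k)).aemeasurable]
  simp_rw [lintegral_indicator_one (hA _), hQ.measure_forall_lt hG.compl]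
  refine ne_top_of_le_ne_top ?_ (ENNReal.tsum_le_tsum fun k =>
    pow_le_pow_right_of_le_one' prob_le_one (Nat.le_succ k))
  rw [ENNReal.tsum_geometric, ENNReal.inv_ne_top]
  exact (tsub_pos_of_lt (IsIIDLaw.compl_lt_one hG h0)).ne'

end Visits

/-! ### Random recursions with a reset -/

/-- A random recursion `x ↦ next (x, y)` driven by independent inputs `y` of law `κ`, with real
outputs `out (x, y)`. An input in the set `reset`, which has positive probability, sends every valid
state to the same state `base` and outputs `0`. -/
structure ResetSystem (𝒳 𝒴 : Type*) [MeasurableSpace 𝒳] [MeasurableSpace 𝒴] where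
  κ : Measure 𝒴
  next : 𝒳 × 𝒴 → 𝒳
  out : 𝒳 × 𝒴 → ℝ
  reset : Set 𝒴
  base : 𝒳
  valid : Set 𝒳
  isProbabilityMeasure : IsProbabilityMeasure κ
  measurable_next : Measurable next
  measurable_out : Measurable out
  measurableSet_reset : MeasurableSet reset
  measurableSet_valid : MeasurableSet valid
  base_mem : base ∈ valid
  next_mem : ∀ᵐ y ∂κ, ∀ x ∈ valid, next (x, y) ∈ valid
  next_of_reset : ∀ x ∈ valid, ∀ y ∈ reset, next (x, y) = base
  out_of_reset : ∀ x ∈ valid, ∀ y ∈ reset, out (x, y) = 0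
  measure_reset : κ reset ≠ 0

namespace ResetSystem

variable {𝒳 𝒴 : Type*} [MeasurableSpace 𝒳] [MeasurableSpace 𝒴] (R : ResetSystem 𝒳 𝒴)

instance : IsProbabilityMeasure R.κ := R.isProbabilityMeasure

/-- The state before the input number `k`. -/
def orbit (x₀ : 𝒳) (ξ : ℕ → 𝒴) : ℕ → 𝒳
  | 0 => x₀
  | k + 1 => R.next (orbit x₀ ξ k, ξ k)

/-- The output number `k`, as a function of the initial state and the inputs. -/
def output (k : ℕ) (ω : 𝒳 × (ℕ → 𝒴)) : ℝ := R.out (R.orbit ω.1 ω.2 k, ω.2 k)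

theorem measurable_orbit (k : ℕ) : Measurable fun ω : 𝒳 × (ℕ → 𝒴) => R.orbit ω.1 ω.2 k := by
  induction k with
  | zero => exact measurable_fst
  | succ k ih =>
    exact R.measurable_next.comp (ih.prodMk ((measurable_pi_apply k).comp measurable_snd))

theorem measurable_output (k : ℕ) : Measurable (R.output k) :=
  R.measurable_out.comp
    ((R.measurable_orbit k).prodMk ((measurable_pi_apply k).comp measurable_snd))

theorem orbit_add (x₀ : 𝒳) (ξ : ℕ → 𝒴) (m k : ℕ) :
    R.orbit x₀ ξ (m + k) = R.orbit (R.orbit x₀ ξ m) (seqDrop m ξ) k := by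
  induction k with
  | zero => rfl
  | succ k ih => rw [← add_assoc, orbit, orbit, ih]; rfl

theorem output_add (x₀ : 𝒳) (ξ : ℕ → 𝒴) (m k : ℕ) :
    R.output (m + k) (x₀, ξ) = R.output k (R.orbit x₀ ξ m, seqDrop m ξ) := by
  simp only [output, orbit_add]
  rfl

theorem orbit_seqFreeze (x₀ : 𝒳) (ξ : ℕ → 𝒴) {m k : ℕ} (h : k ≤ m + 1) :
    R.orbit x₀ (seqFreeze m ξ) k = R.orbit x₀ ξ k := by
  induction k with
  | zero => rfl
  | succ k ih => rw [orbit, orbit, ih (by omega), seqFreeze_apply (by omega)]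

theorem output_seqFreeze (x₀ : 𝒳) (ξ : ℕ → 𝒴) {m k : ℕ} (h : k ≤ m) :
    R.output k (x₀, seqFreeze m ξ) = R.output k (x₀, ξ) := by
  simp only [output, orbit_seqFreeze R x₀ ξ (h.trans m.le_succ), seqFreeze_apply h]

theorem orbit_mem {x₀ : 𝒳} (hx₀ : x₀ ∈ R.valid) {ξ : ℕ → 𝒴}
    (hξ : ∀ k, ∀ x ∈ R.valid, R.next (x, ξ k) ∈ R.valid) (k : ℕ) : R.orbit x₀ ξ k ∈ R.valid := by
  induction k with
  | zero => exact hx₀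
  | succ k ih => exact hξ k _ ih

/-! ### Regeneration at the resets -/

/-- The cycle lengths and the outputs that follow a reset, as a function of the later inputs. The
reset itself outputs `0`, and its cycle ends with the first later reset. -/
noncomputable def cycle (ξ : ℕ → 𝒴) : (ℕ → ℕ) × (ℕ → ℝ) :=
  (fun j => j.casesOn (visit R.reset ξ 0 + 1)
    fun j => visit R.reset ξ (j + 1) - visit R.reset ξ j,
   fun k => k.casesOn 0 fun k => R.output k (R.base, ξ))

/-- The cycle lengths and the outputs from the reset number `n` on. -/
noncomputable def future (n : ℕ) (ω : 𝒳 × (ℕ → 𝒴)) : (ℕ → ℕ) × (ℕ → ℝ) :=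
  (fun m => visit R.reset ω.2 (n + m + 1) - visit R.reset ω.2 (n + m),
   fun k => R.output (visit R.reset ω.2 n + k) ω)

/-- The indices of the resets up to number `n` and the outputs before the last of them. -/
noncomputable def past (n : ℕ) (ω : 𝒳 × (ℕ → 𝒴)) : (Fin (n + 1) → ℕ) × (ℕ → ℝ) :=
  (fun i => visit R.reset ω.2 i, fun k => if k < visit R.reset ω.2 n then R.output k ω else 0)

theorem measurable_cycle : Measurable R.cycle := by
  have hv := fun n => measurable_visit R.measurableSet_reset n
  refine Measurable.prodMk (measurable_pi_iff.2 fun j => ?_) (measurable_pi_iff.2 fun k => ?_)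
  · cases j with
    | zero => exact (hv 0).add_const 1
    | succ j => exact (hv (j + 1)).sub (hv j)
  · cases k with
    | zero => exact measurable_const
    | succ k => exact (R.measurable_output k).comp (measurable_const.prodMk measurable_id)

theorem measurable_visit_snd (n : ℕ) :
    Measurable fun ω : 𝒳 × (ℕ → 𝒴) => visit R.reset ω.2 n :=
  (measurable_visit R.measurableSet_reset n).comp measurable_snd

theorem measurable_future (n : ℕ) : Measurable (R.future n) := by
  refine Measurable.prodMk (measurable_pi_iff.2 fun m => ?_) (measurable_pi_iff.2 fun k => ?_)
  · exact (R.measurable_visit_snd (n + m + 1)).sub (R.measurable_visit_snd (n + m))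
  · have : Measurable fun p : (𝒳 × (ℕ → 𝒴)) × ℕ => R.output (p.2 + k) p.1 :=
      measurable_from_prod_countable_left fun m => R.measurable_output (m + k)
    exact this.comp (measurable_id.prodMk (R.measurable_visit_snd n))

theorem measurable_past (n : ℕ) : Measurable (R.past n) := by
  refine Measurable.prodMk (measurable_pi_iff.2 fun i => R.measurable_visit_snd i)
    (measurable_pi_iff.2 fun k => ?_)
  exact Measurable.ite (measurableSet_lt measurable_const (R.measurable_visit_snd n))
    (R.measurable_output k) measurable_const

/-- The outcomes with a valid initial state, inputs that preserve validity, and infinitely many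
resets. -/
def IsRegular (ω : 𝒳 × (ℕ → 𝒴)) : Prop :=
  ω.1 ∈ R.valid ∧ (∀ k, ∀ x ∈ R.valid, R.next (x, ω.2 k) ∈ R.valid) ∧
    {k | ω.2 k ∈ R.reset}.Infinite

theorem future_eq_cycle {ω : 𝒳 × (ℕ → 𝒴)} (hω : R.IsRegular ω) (n : ℕ) :
    R.future n ω = R.cycle (seqDrop (visit R.reset ω.2 n + 1) ω.2) := by
  classical
  obtain ⟨x₀, ξ⟩ := ω
  obtain ⟨hx, hξ, hinf⟩ := hω
  dsimp only at hx hξ hinf ⊢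
  have hreset : ξ (visit R.reset ξ n) ∈ R.reset := Nat.nth_mem_of_infinite hinf n
  have hmem := R.orbit_mem hx hξ (visit R.reset ξ n)
  refine Prod.ext (funext fun j => ?_) (funext fun k => ?_)
  · cases j with
    | zero =>
      have h1 := visit_add hinf n 0
      change visit R.reset ξ (n + 1) - visit R.reset ξ n =
        visit R.reset (seqDrop (visit R.reset ξ n + 1) ξ) 0 + 1
      rw [add_zero] at h1
      omega
    | succ j =>
      have h1 := visit_add hinf n (j + 1)
      have h2 := visit_add hinf n j
      change visit R.reset ξ (n + (j + 1) + 1) - visit R.reset ξ (n + (j + 1)) =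
        visit R.reset (seqDrop (visit R.reset ξ n + 1) ξ) (j + 1) -
          visit R.reset (seqDrop (visit R.reset ξ n + 1) ξ) j
      rw [show n + (j + 1) + 1 = n + 1 + (j + 1) by omega, show n + (j + 1) = n + 1 + j by omega,
        h1, h2]
      omega
  · cases k with
    | zero => exact R.out_of_reset _ hmem _ hreset
    | succ k =>
      have hb : R.orbit x₀ ξ (visit R.reset ξ n + 1) = R.base := R.next_of_reset _ hmem _ hreset
      change R.output (visit R.reset ξ n + (k + 1)) (x₀, ξ) =
        R.output k (R.base, seqDrop (visit R.reset ξ n + 1) ξ)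
      rw [← hb, ← output_add]
      congr 1
      omega

theorem past_seqFreeze {x₀ : 𝒳} {ξ : ℕ → 𝒴} (hinf : {k | ξ k ∈ R.reset}.Infinite) (n : ℕ) :
    R.past n (x₀, seqFreeze (visit R.reset ξ n) ξ) = R.past n (x₀, ξ) := by
  have hv : ∀ i ≤ n, visit R.reset (seqFreeze (visit R.reset ξ n) ξ) i = visit R.reset ξ i :=
    fun i hi => visit_seqFreeze hinf ((visit_strictMono hinf).monotone hi)
  refine Prod.ext (funext fun i => hv i (Nat.lt_succ_iff.1 i.2)) (funext fun k => ?_)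
  simp only [past, hv n le_rfl]
  split_ifs with hk
  · exact R.output_seqFreeze x₀ ξ hk.le
  · rfl

variable {R} {Q : Measure (ℕ → 𝒴)} {ν : Measure 𝒳}

theorem measure_eq_tsum_visit (n : ℕ) {S : Set (𝒳 × (ℕ → 𝒴))} (hS : MeasurableSet S) :
    ν.prod Q S = ∑' m, ν.prod Q ({ω | visit R.reset ω.2 n = m} ∩ S) := by
  rw [← measure_iUnion]
  · congr 1
    ext ω
    simp
  · intro i j hij
    refine Set.disjoint_left.2 ?_
    rintro ω ⟨h1, -⟩ ⟨h2, -⟩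
    exact hij (h1.symm.trans h2)
  · exact fun m => (R.measurable_visit_snd n (measurableSet_singleton m)).inter hS

variable [IsProbabilityMeasure ν]

theorem ae_isRegular (hQ : IsIIDLaw R.κ Q) (hν : ∀ᵐ x ∂ν, x ∈ R.valid) :
    ∀ᵐ ω ∂ν.prod Q, R.IsRegular ω := by
  have := hQ.isProbabilityMeasure
  filter_upwards [measurePreserving_fst.quasiMeasurePreserving.ae hν,
    (measurePreserving_snd (μ := ν) (ν := Q)).quasiMeasurePreserving.ae (hQ.ae_forall R.next_mem),
    (measurePreserving_snd (μ := ν) (ν := Q)).quasiMeasurePreserving.ae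
      (hQ.ae_infinite R.measurableSet_reset R.measure_reset)] with ω h1 h2 h3
  exact ⟨h1, h2, h3⟩

/-- The initial state and the inputs up to number `m` are independent of the later inputs. -/
theorem measure_freeze_inter_drop (hQ : IsIIDLaw R.κ Q) (m : ℕ) {E : Set (𝒳 × (ℕ → 𝒴))}
    (hE : MeasurableSet E) {C : Set (ℕ → 𝒴)} (hC : MeasurableSet C) :
    ν.prod Q {ω | (ω.1, seqFreeze m ω.2) ∈ E ∧ seqDrop (m + 1) ω.2 ∈ C} =
      ν.prod Q {ω | (ω.1, seqFreeze m ω.2) ∈ E} * Q C := by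
  have := hQ.isProbabilityMeasure
  have hf := measurable_seqFreeze (𝒴 := 𝒴) m
  have hζ : IsProbabilityMeasure (Q.map (seqFreeze m)) :=
    Measure.isProbabilityMeasure_map hf.aemeasurable
  have h1 : MeasurePreserving (fun ξ => (seqFreeze m ξ, seqDrop (m + 1) ξ)) Q
      ((Q.map (seqFreeze m)).prod Q) :=
    ⟨hf.prodMk (measurable_seqDrop (m + 1)), hQ.map_freeze_drop m⟩
  have h2 := ((measurePreserving_prodAssoc ν (Q.map (seqFreeze m)) Q).symm).comp
    ((MeasurePreserving.id ν).prod h1)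
  have h3 := h2.measure_preimage (hE.prod hC).nullMeasurableSet
  have h4 := (measurePreserving_fst.comp h2).measure_preimage hE.nullMeasurableSet
  rw [Measure.prod_prod, ← h4] at h3
  exact h3

/-- At each reset the future is independent of the past, and its law is that of a cycle. -/
theorem measure_future_inter_past (hQ : IsIIDLaw R.κ Q) (hν : ∀ᵐ x ∂ν, x ∈ R.valid) (n : ℕ)
    {A : Set ((ℕ → ℕ) × (ℕ → ℝ))} (hA : MeasurableSet A)
    {B : Set ((Fin (n + 1) → ℕ) × (ℕ → ℝ))} (hB : MeasurableSet B) :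
    ν.prod Q (R.future n ⁻¹' A ∩ R.past n ⁻¹' B) =
      Q (R.cycle ⁻¹' A) * ν.prod Q (R.past n ⁻¹' B) := by
  classical
  have hF := R.measurable_future n hA
  have hP := R.measurable_past n hB
  rw [measure_eq_tsum_visit (R := R) n (hF.inter hP), measure_eq_tsum_visit (R := R) n hP,
    ← ENNReal.tsum_mul_left]
  refine tsum_congr fun m => ?_
  -- that `m` is the reset number `n`, with the past in `B`, is visible from the inputs up to `m`
  set E : Set (𝒳 × (ℕ → 𝒴)) := {ω | ω.2 m ∈ R.reset ∧
    Nat.count (fun k => ω.2 k ∈ R.reset) m = n ∧ R.past n ω ∈ B} with hE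
  have hEm : MeasurableSet E :=
    (((measurable_pi_apply m).comp measurable_snd) R.measurableSet_reset).inter
      ((((measurable_count_visits R.measurableSet_reset m).comp measurable_snd)
        (measurableSet_singleton n)).inter hP)
  have hiff : ∀ ω, R.IsRegular ω → ((ω.1, seqFreeze m ω.2) ∈ E ↔
      visit R.reset ω.2 n = m ∧ R.past n ω ∈ B) := by
    rintro ⟨x₀, ξ⟩ ⟨-, -, hinf⟩
    simp only [hE, Set.mem_ofPred_eq, seqFreeze_apply le_rfl, count_seqFreeze m.le_succ]
    rw [visit_eq_iff hinf, and_assoc]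
    refine and_congr_right fun h1 => and_congr_right fun h2 => ?_
    have h3 := (visit_eq_iff hinf).2 ⟨h1, h2⟩
    rw [← R.past_seqFreeze hinf n, h3]
  have h1 : ν.prod Q ({ω | visit R.reset ω.2 n = m} ∩ R.past n ⁻¹' B) =
      ν.prod Q {ω | (ω.1, seqFreeze m ω.2) ∈ E} := by
    refine measure_congr ?_
    filter_upwards [ae_isRegular hQ hν] with ω hω
    exact propext (hiff ω hω).symm
  have h2 : ν.prod Q ({ω | visit R.reset ω.2 n = m} ∩ (R.future n ⁻¹' A ∩ R.past n ⁻¹' B)) =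
      ν.prod Q {ω | (ω.1, seqFreeze m ω.2) ∈ E ∧ seqDrop (m + 1) ω.2 ∈ R.cycle ⁻¹' A} := by
    refine measure_congr ?_
    filter_upwards [ae_isRegular hQ hν] with ω hω
    refine propext ?_
    change (visit R.reset ω.2 n = m ∧ R.future n ω ∈ A ∧ R.past n ω ∈ B) ↔
      (ω.1, seqFreeze m ω.2) ∈ E ∧ R.cycle (seqDrop (m + 1) ω.2) ∈ A
    rw [hiff ω hω, R.future_eq_cycle hω n]
    constructor
    · rintro ⟨rfl, h3, h4⟩
      exact ⟨⟨rfl, h4⟩, h3⟩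
    · rintro ⟨⟨rfl, h4⟩, h3⟩
      exact ⟨rfl, h3, h4⟩
  rw [h1, h2, measure_freeze_inter_drop hQ m hEm (R.measurable_cycle hA), mul_comm]

theorem measure_future (hQ : IsIIDLaw R.κ Q) (hν : ∀ᵐ x ∂ν, x ∈ R.valid) (n : ℕ)
    {A : Set ((ℕ → ℕ) × (ℕ → ℝ))} (hA : MeasurableSet A) :
    ν.prod Q (R.future n ⁻¹' A) = Q (R.cycle ⁻¹' A) := by
  have := hQ.isProbabilityMeasure
  simpa using measure_future_inter_past hQ hν n hA .univ

theorem identDistrib_future_cycle (hQ : IsIIDLaw R.κ Q) (hν : ∀ᵐ x ∂ν, x ∈ R.valid) (n : ℕ) :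
    IdentDistrib (R.future n) R.cycle (ν.prod Q) Q where
  aemeasurable_fst := (R.measurable_future n).aemeasurable
  aemeasurable_snd := R.measurable_cycle.aemeasurable
  map_eq := by
    ext A hA
    rw [Measure.map_apply (R.measurable_future n) hA, Measure.map_apply R.measurable_cycle hA,
      measure_future hQ hν n hA]

theorem isRegenerative_output (hQ : IsIIDLaw R.κ Q) (hν : ∀ᵐ x ∂ν, x ∈ R.valid) :
    IsRegenerative (ν.prod Q) R.output (fun n ω => visit R.reset ω.2 n) where
  measurable_process := R.measurable_output
  measurable_epoch := R.measurable_visit_snd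
  strictMono := by
    filter_upwards [ae_isRegular hQ hν] with ω hω
    exact visit_strictMono hω.2.2
  indep n := by
    change IndepFun (R.future n) (R.past n) (ν.prod Q)
    rw [indepFun_iff_measure_inter_preimage_eq_mul]
    intro A B hA hB
    rw [measure_future_inter_past hQ hν n hA hB, measure_future hQ hν n hA]
  identDistrib n :=
    (identDistrib_future_cycle hQ hν n).trans (identDistrib_future_cycle hQ hν 0).symm

theorem isAperiodicRegenerative_output (hQ : IsIIDLaw R.κ Q) (hν : ∀ᵐ x ∂ν, x ∈ R.valid) :
    IsAperiodicRegenerative (ν.prod Q) R.output := by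
  have := hQ.isProbabilityMeasure
  have hlen : Measurable fun c : (ℕ → ℕ) × (ℕ → ℝ) => c.1 0 :=
    (measurable_pi_apply 0).comp measurable_fst
  refine ⟨_, isRegenerative_output hQ hν, fun d hd => Nat.dvd_one.1 (hd 1 ?_), ?_⟩
  -- a cycle has length `1` if the first input after the reset is again a reset
  · have h := measure_future hQ hν 0 (hlen (measurableSet_singleton 1))
    change ν.prod Q (R.future 0 ⁻¹' ((fun c => c.1 0) ⁻¹' {1})) ≠ 0
    rw [h]
    refine fun h0 => R.measure_reset ?_
    rw [← (hQ.measurePreserving_eval 0).measure_preimage R.measurableSet_reset.nullMeasurableSet]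
    refine measure_mono_null (fun ξ (hξ : ξ 0 ∈ R.reset) => ?_) h0
    change visit R.reset ξ 0 + 1 = 1
    have := visit_eq_of_count hξ
    simpa using this
  · have hint : Integrable (fun ξ => ((R.cycle ξ).1 0 : ℝ)) Q := by
      have hm : Measurable fun ξ : ℕ → 𝒴 => (visit R.reset ξ 0 : ℝ) :=
        measurable_from_top.comp (measurable_visit R.measurableSet_reset 0)
      have hv : Integrable (fun ξ => (visit R.reset ξ 0 : ℝ)) Q := by
        refine ⟨hm.aestronglyMeasurable, ?_⟩
        rw [hasFiniteIntegral_iff_ofReal (ae_of_all _ fun _ => Nat.cast_nonneg _)]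
        simp_rw [ENNReal.ofReal_natCast]
        exact (lintegral_visit_zero_ne_top hQ R.measurableSet_reset R.measure_reset).lt_top
      refine (hv.add (integrable_const 1)).congr (ae_of_all _ fun ξ => ?_)
      change (visit R.reset ξ 0 : ℝ) + 1 = ((visit R.reset ξ 0 + 1 : ℕ) : ℝ)
      push_cast
      rfl
    have hcast : Measurable fun c : (ℕ → ℕ) × (ℕ → ℝ) => (c.1 0 : ℝ) :=
      measurable_from_top.comp hlen
    have h := (((identDistrib_future_cycle hQ hν 0).comp hcast).integrable_iff).2 hint
    refine h.congr ?_
    filter_upwards [ae_isRegular hQ hν] with ω hω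
    change ((visit R.reset ω.2 1 - visit R.reset ω.2 0 : ℕ) : ℝ) = _
    rw [Nat.cast_sub (visit_strictMono hω.2.2 zero_lt_one).le]

end ResetSystem

/-! ### Transfer along measure preserving maps -/

section Transfer

variable {Ω Ω' α : Type*} [MeasurableSpace Ω] [MeasurableSpace Ω'] [MeasurableSpace α]
  {μ : Measure Ω} {μ' : Measure Ω'} {φ : Ω → Ω'}

theorem MeasureTheory.MeasurePreserving.identDistrib_comp (hφ : MeasurePreserving φ μ μ')
    {f : Ω' → α} (hf : AEMeasurable f μ') : IdentDistrib (f ∘ φ) f μ μ' where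
  aemeasurable_fst := hf.comp_quasiMeasurePreserving hφ.quasiMeasurePreserving
  aemeasurable_snd := hf
  map_eq := by
    rw [← AEMeasurable.map_map_of_aemeasurable (by rwa [hφ.map_eq]) hφ.aemeasurable, hφ.map_eq]

theorem IsAperiodicRegenerative.comp {X : ℕ → Ω' → ℝ} (h : IsAperiodicRegenerative μ' X)
    (hφ : MeasurePreserving φ μ μ') : IsAperiodicRegenerative μ fun k ω => X k (φ ω) := by
  obtain ⟨S, hS, hd, hint⟩ := h
  have hpair : ∀ n, Measurable fun ω => ((S n ω, ω) : ℕ × Ω') := fun n =>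
    (hS.measurable_epoch n).prodMk measurable_id
  have hfut : ∀ n, Measurable (fun ω => ((fun m => S (n + m + 1) ω - S (n + m) ω,
      fun k => X (S n ω + k) ω) : (ℕ → ℕ) × (ℕ → ℝ))) := fun n => by
    refine Measurable.prodMk (measurable_pi_iff.2 fun m => ?_) (measurable_pi_iff.2 fun k => ?_)
    · exact (hS.measurable_epoch _).sub (hS.measurable_epoch _)
    · have : Measurable fun p : ℕ × Ω' => X (p.1 + k) p.2 :=
        measurable_from_prod_countable_right fun m => hS.measurable_process (m + k)
      exact this.comp (hpair n)
  have hpast : ∀ n, Measurable (fun ω => ((fun i => S i ω, fun k => if k < S n ω then X k ω else 0) :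
      (Fin (n + 1) → ℕ) × (ℕ → ℝ))) := fun n => by
    refine Measurable.prodMk (measurable_pi_iff.2 fun i => hS.measurable_epoch i)
      (measurable_pi_iff.2 fun k => ?_)
    exact Measurable.ite (measurableSet_lt measurable_const (hS.measurable_epoch n))
      (hS.measurable_process k) measurable_const
  refine ⟨fun n ω => S n (φ ω), ⟨fun k => (hS.measurable_process k).comp hφ.measurable,
    fun n => (hS.measurable_epoch n).comp hφ.measurable,
    hφ.quasiMeasurePreserving.ae hS.strictMono, fun n => ?_, fun n => ?_⟩, fun d h => hd d ?_, ?_⟩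
  · rw [indepFun_iff_measure_inter_preimage_eq_mul]
    intro A B hA hB
    have h := (indepFun_iff_measure_inter_preimage_eq_mul.1 (hS.indep n)) A B hA hB
    rw [← hφ.measure_preimage (((hfut n) hA).inter ((hpast n) hB)).nullMeasurableSet,
      ← hφ.measure_preimage ((hfut n) hA).nullMeasurableSet,
      ← hφ.measure_preimage ((hpast n) hB).nullMeasurableSet] at h
    exact h
  · exact ((hφ.identDistrib_comp (hfut n).aemeasurable).trans (hS.identDistrib n)).trans
      (hφ.identDistrib_comp (hfut 0).aemeasurable).symm
  · intro m hm
    refine h m ?_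
    have hms : MeasurableSet {ω | S 1 ω - S 0 ω = m} :=
      ((hS.measurable_epoch 1).sub (hS.measurable_epoch 0)) (measurableSet_singleton m)
    rwa [← hφ.measure_preimage hms.nullMeasurableSet] at hm
  · exact hφ.integrable_comp_of_integrable hint

end Transfer

/-! ### The stationary law of a random recursion with a reset -/

namespace ResetSystem

variable {𝒳 𝒴 : Type*} [MeasurableSpace 𝒳] [MeasurableSpace 𝒴] (R : ResetSystem 𝒳 𝒴)

/-- The law of the state `n` steps after a reset, restricted to the event that no further reset has
occurred in between. -/
noncomputable def killed : ℕ → Measure 𝒳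
  | 0 => Measure.dirac R.base
  | n + 1 => ((killed n).prod (R.κ.restrict R.resetᶜ)).map R.next

/-- The law of the state when the age of the last reset has its stationary geometric law. -/
noncomputable def stationary : Measure 𝒳 := Measure.sum fun n => R.κ R.reset • R.killed n

instance (n : ℕ) : IsFiniteMeasure (R.killed n) := by
  induction n with
  | zero => exact inferInstanceAs (IsFiniteMeasure (Measure.dirac R.base))
  | succ n ih =>
    exact inferInstanceAs
      (IsFiniteMeasure (((R.killed n).prod (R.κ.restrict R.resetᶜ)).map R.next))

theorem killed_univ (n : ℕ) : R.killed n Set.univ = R.κ R.resetᶜ ^ n := by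
  induction n with
  | zero => simp [killed]
  | succ n ih =>
    rw [killed, Measure.map_apply R.measurable_next .univ, Set.preimage_univ, ← Set.univ_prod_univ,
      Measure.prod_prod, ih, Measure.restrict_apply_univ, pow_succ]

theorem ae_killed_valid (n : ℕ) : ∀ᵐ x ∂(R.killed n), x ∈ R.valid := by
  induction n with
  | zero =>
    rw [killed, ae_dirac_iff (p := (· ∈ R.valid)) R.measurableSet_valid]
    exact R.base_mem
  | succ n ih =>
    rw [killed, ae_map_iff (p := (· ∈ R.valid)) R.measurable_next.aemeasurable R.measurableSet_valid]
    filter_upwards [Measure.quasiMeasurePreserving_fst.ae ih,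
      Measure.quasiMeasurePreserving_snd.ae (ae_restrict_of_ae R.next_mem)] with p h1 h2
    exact h2 p.1 h1

theorem map_killed_reset (n : ℕ) :
    ((R.killed n).prod (R.κ.restrict R.reset)).map R.next =
      (R.κ R.resetᶜ ^ n * R.κ R.reset) • Measure.dirac R.base := by
  have h : R.next =ᵐ[(R.killed n).prod (R.κ.restrict R.reset)] fun _ => R.base := by
    filter_upwards [Measure.quasiMeasurePreserving_fst.ae (R.ae_killed_valid n),
      Measure.quasiMeasurePreserving_snd.ae (ae_restrict_mem R.measurableSet_reset)] with p h1 h2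
    exact R.next_of_reset _ h1 _ h2
  rw [Measure.map_congr h, Measure.map_const, ← Set.univ_prod_univ, Measure.prod_prod,
    killed_univ, Measure.restrict_apply_univ]

theorem tsum_geometric_reset : ∑' n, R.κ R.resetᶜ ^ n * R.κ R.reset = 1 := by
  rw [ENNReal.tsum_mul_right, ENNReal.tsum_geometric, prob_compl_eq_one_sub R.measurableSet_reset,
    ENNReal.sub_sub_cancel ENNReal.one_ne_top prob_le_one,
    ENNReal.inv_mul_cancel R.measure_reset (measure_ne_top _ _)]

instance : IsProbabilityMeasure R.stationary := by
  constructor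
  rw [stationary, Measure.sum_apply _ .univ, ← R.tsum_geometric_reset]
  refine tsum_congr fun n => ?_
  rw [Measure.smul_apply, killed_univ, smul_eq_mul, mul_comm]

theorem ae_stationary_valid : ∀ᵐ x ∂(R.stationary), x ∈ R.valid := by
  rw [stationary, Measure.ae_sum_iff' (p := (· ∈ R.valid)) R.measurableSet_valid]
  exact fun n => Measure.ae_smul_measure (R.ae_killed_valid n) _

/-- The law `stationary` is invariant under the recursion: without a reset the age of the last
reset grows by one, and with a reset the state starts afresh. -/
theorem map_next_stationary : (R.stationary.prod R.κ).map R.next = R.stationary := by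
  have hstep : ∀ n, ((R.killed n).prod R.κ).map R.next =
      R.killed (n + 1) + (R.κ R.resetᶜ ^ n * R.κ R.reset) • Measure.dirac R.base := by
    intro n
    rw [← R.map_killed_reset, killed, ← Measure.map_add _ _ R.measurable_next, ← Measure.prod_add,
      add_comm (R.κ.restrict R.resetᶜ), Measure.restrict_add_restrict_compl R.measurableSet_reset]
  ext s hs
  rw [stationary, Measure.prod_sum_left, Measure.map_sum R.measurable_next.aemeasurable,
    Measure.sum_apply _ hs, Measure.sum_apply _ hs]
  simp_rw [Measure.prod_smul_left, Measure.map_smul, hstep, Measure.smul_apply, Measure.add_apply,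
    Measure.smul_apply, smul_eq_mul, mul_add]
  rw [ENNReal.tsum_add, ENNReal.tsum_mul_left, ENNReal.tsum_mul_left, ENNReal.tsum_mul_right,
    R.tsum_geometric_reset, one_mul, ENNReal.tsum_mul_left,
    tsum_eq_zero_add' (f := fun n => R.killed n s) ENNReal.summable, ← mul_add, add_comm]
  rfl

variable {R} {Q : Measure (ℕ → 𝒴)}

/-- Started from the stationary law, the state after one step and the later inputs are distributed
as the initial state and the inputs. -/
theorem measurePreserving_step (hQ : IsIIDLaw R.κ Q) :
    MeasurePreserving (fun ω : 𝒳 × (ℕ → 𝒴) => (R.next (ω.1, ω.2 0), seqDrop 1 ω.2))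
      (R.stationary.prod Q) (R.stationary.prod Q) := by
  have := hQ.isProbabilityMeasure
  have h1 : MeasurePreserving R.next (R.stationary.prod R.κ) R.stationary :=
    ⟨R.measurable_next, R.map_next_stationary⟩
  have h := (h1.prod (MeasurePreserving.id Q)).comp
    (((measurePreserving_prodAssoc R.stationary R.κ Q).symm).comp
      ((MeasurePreserving.id R.stationary).prod hQ.measurePreserving_head_tail))
  convert h using 1
  funext ω
  refine Prod.ext rfl (funext fun k => ?_)
  simp [seqDrop, add_comm, MeasurableEquiv.prodAssoc]

theorem isStrictlyStationary_output (hQ : IsIIDLaw R.κ Q) :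
    IsStrictlyStationary (R.stationary.prod Q) R.output := by
  have h := (measurePreserving_step hQ).identDistrib_comp
    (f := fun ω k => R.output k ω) (measurable_pi_iff.2 R.measurable_output).aemeasurable
  have heq : (fun (ω : 𝒳 × (ℕ → 𝒴)) k => R.output (k + 1) ω) =
      (fun ω k => R.output k ω) ∘ fun ω => (R.next (ω.1, ω.2 0), seqDrop 1 ω.2) := by
    funext ω k
    obtain ⟨x₀, ξ⟩ := ω
    rw [add_comm, output_add]
    rfl
  rw [IsStrictlyStationary, heq]
  exact h

/-- Two orbits with the same inputs agree after the first reset. -/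
theorem orbit_eq_of_reset {x y : 𝒳} (hx : x ∈ R.valid) (hy : y ∈ R.valid) {ξ : ℕ → 𝒴}
    (hξ : ∀ k, ∀ x ∈ R.valid, R.next (x, ξ k) ∈ R.valid) {j k : ℕ} (hjk : j < k)
    (hj : ξ j ∈ R.reset) : R.orbit x ξ k = R.orbit y ξ k := by
  obtain ⟨i, rfl⟩ := Nat.exists_eq_add_of_le (Nat.succ_le_of_lt hjk)
  rw [orbit_add, orbit_add R y]
  congr 1
  change R.next _ = R.next _
  rw [R.next_of_reset _ (R.orbit_mem hx hξ j) _ hj, R.next_of_reset _ (R.orbit_mem hy hξ j) _ hj]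

/-- Coupling: from any two valid initial laws, the laws of the output number `k` differ by at most
the probability that none of the first `k` inputs is a reset. -/
theorem measure_output_le (hQ : IsIIDLaw R.κ Q) {ν ν' : Measure 𝒳} [IsProbabilityMeasure ν]
    [IsProbabilityMeasure ν'] (hν : ∀ᵐ x ∂ν, x ∈ R.valid) (hν' : ∀ᵐ x ∂ν', x ∈ R.valid) (k : ℕ)
    {B : Set ℝ} (hB : MeasurableSet B) :
    ν.prod Q (R.output k ⁻¹' B) ≤ ν'.prod Q (R.output k ⁻¹' B) + R.κ R.resetᶜ ^ k := by
  have := hQ.isProbabilityMeasure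
  -- both systems live on one space, with independent initial states and the same inputs
  have h1 : MeasurePreserving (fun p : 𝒳 × (𝒳 × (ℕ → 𝒴)) => (p.1, p.2.2))
      (ν.prod (ν'.prod Q)) (ν.prod Q) :=
    (MeasurePreserving.id ν).prod measurePreserving_snd
  have h2 : MeasurePreserving (fun p : 𝒳 × (𝒳 × (ℕ → 𝒴)) => p.2)
      (ν.prod (ν'.prod Q)) (ν'.prod Q) := measurePreserving_snd
  have h3 : MeasurePreserving (fun p : 𝒳 × (𝒳 × (ℕ → 𝒴)) => p.2.2)
      (ν.prod (ν'.prod Q)) Q := measurePreserving_snd.comp measurePreserving_snd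
  have hN : MeasurableSet {ξ : ℕ → 𝒴 | ∀ j < k, ξ j ∈ R.resetᶜ} := by
    simp only [Set.ofPred_forall]
    exact .iInter fun j => .iInter fun _ => measurable_pi_apply j R.measurableSet_reset.compl
  rw [← hQ.measure_forall_lt R.measurableSet_reset.compl,
    ← h1.measure_preimage (R.measurable_output k hB).nullMeasurableSet,
    ← h2.measure_preimage (R.measurable_output k hB).nullMeasurableSet,
    ← h3.measure_preimage hN.nullMeasurableSet]
  refine le_trans (measure_mono_ae ?_) (measure_union_le _ _)
  filter_upwards [Measure.quasiMeasurePreserving_fst.ae hν,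
    h2.quasiMeasurePreserving.ae (measurePreserving_fst.quasiMeasurePreserving.ae hν'),
    h3.quasiMeasurePreserving.ae (hQ.ae_forall R.next_mem)] with p hp1 hp2 hp3
  intro hp
  by_cases hres : ∀ j < k, p.2.2 j ∈ R.resetᶜ
  · exact Or.inr hres
  · push Not at hres
    obtain ⟨j, hj, hjr⟩ := hres
    refine Or.inl ?_
    change R.output k p.2 ∈ B
    have hp' : R.output k (p.1, p.2.2) ∈ B := hp
    have := orbit_eq_of_reset hp1 hp2 hp3 hj (not_not.1 hjr)
    rwa [output, this] at hp'

/-- The law of the output in a stationary regime is unique. -/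
theorem law_output_unique (hQ : IsIIDLaw R.κ Q) {ν ν' : Measure 𝒳} [IsProbabilityMeasure ν]
    [IsProbabilityMeasure ν'] (hν : ∀ᵐ x ∂ν, x ∈ R.valid) (hν' : ∀ᵐ x ∂ν', x ∈ R.valid)
    {π π' : Measure ℝ} (hπ : ∀ k, (ν.prod Q).map (R.output k) = π)
    (hπ' : ∀ k, (ν'.prod Q).map (R.output k) = π') : π ≤ π' := by
  refine Measure.le_iff.2 fun B hB => ?_
  have hlim : Filter.Tendsto (fun k => π' B + R.κ R.resetᶜ ^ k) Filter.atTop (nhds (π' B + 0)) :=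
    tendsto_const_nhds.add (ENNReal.tendsto_pow_atTop_nhds_zero_of_lt_one
      (IsIIDLaw.compl_lt_one R.measurableSet_reset R.measure_reset))
  rw [add_zero] at hlim
  refine ge_of_tendsto' hlim fun k => ?_
  rw [← hπ k, ← hπ' k, Measure.map_apply (R.measurable_output k) hB,
    Measure.map_apply (R.measurable_output k) hB]
  exact measure_output_le hQ hν hν' k hB

end ResetSystem

/-! ### The queues as a random recursion with a reset -/

instance (M : ℕ) : Countable (FileQueue M) :=
  inferInstanceAs (Countable {l : List (Fin M) // l.Nodup})

instance (M : ℕ) : MeasurableSingletonClass (FileQueue M) := ⟨fun _ => trivial⟩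

theorem FileQueue.length_le {M : ℕ} (q : FileQueue M) : q.1.length ≤ M := by
  simpa using q.2.length_le_card

namespace PCSM

variable (P : PCSM)

theorem serviceTime_pos : 0 < P.serviceTime := by
  have hL : (0 : ℝ) < P.L := Nat.cast_pos.2 P.L_pos
  have hM : (0 : ℝ) < P.M := P.cacheSize_nonneg.trans_lt P.cacheSize_lt
  have hC := P.cacheSize_nonneg
  have h1 : 0 < 1 - P.cacheSize / P.M := sub_pos.2 ((div_lt_one hM).2 P.cacheSize_lt)
  have hF := P.fileSize_pos
  have hR := P.linkRate_pos
  unfold serviceTime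
  positivity

/-- The queues of all users when nobody waits. -/
def emptyQueues : Fin P.L → FileQueue P.M := fun _ => ⟨[], List.nodup_nil⟩

theorem eq_emptyQueues {q : Fin P.L → FileQueue P.M} (h : ∀ j, (q j).1 = []) :
    q = P.emptyQueues :=
  funext fun j => Subtype.ext (h j)

theorem pop_length_le {q : Fin P.L → FileQueue P.M} {n : ℕ} (h : ∀ j, (q j).1.length ≤ n + 1)
    (j : Fin P.L) : (q j).pop.1.length ≤ n := by
  have := h j
  simp only [FileQueue.pop, List.length_tail]
  omega

theorem measurable_advance_of_length_le (n : ℕ) : ∀ q : Fin P.L → FileQueue P.M,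
    (∀ j, (q j).1.length ≤ n) → Measurable fun p : ℝ × ℝ => P.advance q p.1 p.2 := by
  have hlt : MeasurableSet {p : ℝ × ℝ | p.2 < p.1} := measurableSet_lt measurable_snd measurable_fst
  induction n with
  | zero =>
    intro q hq
    have hq' : ∀ j, (q j).1 = [] := fun j => List.length_eq_zero_iff.1 (Nat.le_zero.1 (hq j))
    have : (fun p : ℝ × ℝ => P.advance q p.1 p.2) =
        fun p => if p.2 < p.1 then (q, p.1 - p.2) else (q, 0) := by
      funext p
      rw [advance, dif_pos hq']
    rw [this]
    exact Measurable.ite hlt (by fun_prop) (by fun_prop)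
  | succ n ih =>
    intro q hq
    by_cases hq' : ∀ j, (q j).1 = []
    · have : (fun p : ℝ × ℝ => P.advance q p.1 p.2) =
          fun p => if p.2 < p.1 then (q, p.1 - p.2) else (q, 0) := by
        funext p
        rw [advance, dif_pos hq']
      rw [this]
      exact Measurable.ite hlt (by fun_prop) (by fun_prop)
    · have : (fun p : ℝ × ℝ => P.advance q p.1 p.2) = fun p => if p.2 < p.1 then (q, p.1 - p.2)
          else P.advance (fun j => (q j).pop) P.serviceTime (p.2 - p.1) := by
        funext p
        rw [advance, dif_neg hq']
      rw [this]
      have h := (ih _ (P.pop_length_le hq)).comp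
        (f := fun p : ℝ × ℝ => (P.serviceTime, p.2 - p.1)) (by fun_prop)
      exact Measurable.ite hlt (by fun_prop) h

theorem measurable_advance : Measurable fun p : P.State × ℝ => P.advance p.1.1 p.1.2 p.2 := by
  have : Measurable fun p : (Fin P.L → FileQueue P.M) × (ℝ × ℝ) => P.advance p.1 p.2.1 p.2.2 :=
    measurable_from_prod_countable_right fun q =>
      P.measurable_advance_of_length_le P.M q fun j => (q j).length_le
  exact this.comp (f := fun p : P.State × ℝ => (p.1.1, (p.1.2, p.2))) (by fun_prop)

theorem measurable_arrive (i : Fin P.M) (j : Fin P.L) : Measurable fun x => P.arrive x i j := by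
  unfold arrive
  refine Measurable.ite (measurable_snd (measurableSet_singleton 0)) (by fun_prop) ?_
  exact ((measurable_of_countable fun q : Fin P.L → FileQueue P.M =>
    Function.update q j ((q j).join i)).comp measurable_fst).prodMk measurable_snd

theorem measurable_delay (i : Fin P.M) (j : Fin P.L) : Measurable fun x => P.delay x i j := by
  unfold delay
  refine Measurable.ite (measurable_snd (measurableSet_singleton 0)) (by fun_prop) ?_
  exact measurable_snd.add (((measurable_of_countable fun q : Fin P.L → FileQueue P.M =>
    (((q j).1.idxOf i : ℕ) : ℝ)).comp measurable_fst).mul_const _)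

theorem measurableSet_admissible : MeasurableSet {x | P.Admissible x} := by
  have h1 : MeasurableSet {x : P.State | 0 ≤ x.2} := measurableSet_le measurable_const measurable_snd
  have h2 : MeasurableSet {x : P.State | x.2 ≤ P.serviceTime} :=
    measurableSet_le measurable_snd measurable_const
  have h3 : MeasurableSet {x : P.State | x.2 = 0} := measurable_snd (measurableSet_singleton 0)
  have h4 : MeasurableSet {x : P.State | ∀ j, (x.1 j).1 = []} :=
    measurable_fst (Set.to_countable {q : Fin P.L → FileQueue P.M | ∀ j, (q j).1 = []}).measurableSet
  have : {x | P.Admissible x} = {x : P.State | 0 ≤ x.2} ∩ ({x | x.2 ≤ P.serviceTime} ∩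
      ({x | x.2 = 0}ᶜ ∪ {x | ∀ j, (x.1 j).1 = []})) := by
    ext x
    simp only [Admissible, Set.mem_ofPred_eq, Set.mem_inter_iff, Set.mem_union, Set.mem_compl_iff,
      imp_iff_not_or]
  rw [this]
  exact h1.inter (h2.inter (h3.compl.union h4))

theorem admissible_advance {t : ℝ} (ht : 0 ≤ t) (n : ℕ) : ∀ (q : Fin P.L → FileQueue P.M) (r : ℝ),
    (∀ j, (q j).1.length ≤ n) → P.Admissible (q, r) → P.Admissible (P.advance q r t) := by
  have hs := P.serviceTime_pos
  induction n generalizing t with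
  | zero =>
    rintro q r hq ⟨h0, h1, -⟩
    have hq' : ∀ j, (q j).1 = [] := fun j => List.length_eq_zero_iff.1 (Nat.le_zero.1 (hq j))
    rw [advance, dif_pos hq']
    split_ifs with h
    · exact ⟨(sub_pos.2 h).le, by dsimp only at h1 ⊢; linarith, fun _ => hq'⟩
    · exact ⟨le_rfl, hs.le, fun _ => hq'⟩
  | succ n ih =>
    rintro q r hq ⟨h0, h1, h2⟩
    rw [advance]
    split_ifs with h hq'
    · exact ⟨(sub_pos.2 h).le, by dsimp only at h1 ⊢; linarith, fun h' => absurd h' (sub_pos.2 h).ne'⟩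
    · exact ⟨le_rfl, hs.le, fun _ => hq'⟩
    · exact ih (sub_nonneg.2 (not_lt.1 h)) _ _ (P.pop_length_le hq)
        ⟨hs.le, le_rfl, fun h' => absurd h' hs.ne'⟩

theorem admissible_arrive {x : P.State} (hx : P.Admissible x) (i : Fin P.M) (j : Fin P.L) :
    P.Admissible (P.arrive x i j) := by
  have hs := P.serviceTime_pos
  unfold arrive
  split_ifs with h
  · exact ⟨hs.le, le_rfl, fun h' => absurd h' hs.ne'⟩
  · exact ⟨hx.1, hx.2.1, fun h' => absurd h' h⟩

/-- After the residual time and one service time for each waiting request of the longest queue, the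
server is idle. -/
theorem advance_eq_idle (n : ℕ) : ∀ (q : Fin P.L → FileQueue P.M) (r t : ℝ),
    (∀ j, (q j).1.length ≤ n) → r + n * P.serviceTime ≤ t →
      P.advance q r t = (P.emptyQueues, 0) := by
  have hs := P.serviceTime_pos
  induction n with
  | zero =>
    intro q r t hq ht
    have hq' : ∀ j, (q j).1 = [] := fun j => List.length_eq_zero_iff.1 (Nat.le_zero.1 (hq j))
    rw [Nat.cast_zero, zero_mul, add_zero] at ht
    rw [advance, if_neg ht.not_gt, dif_pos hq', P.eq_emptyQueues hq']
  | succ n ih =>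
    intro q r t hq ht
    push_cast at ht
    have hn : 0 ≤ (n : ℝ) * P.serviceTime := by positivity
    rw [advance, if_neg (by linarith)]
    split_ifs with hq'
    · rw [P.eq_emptyQueues hq']
    · exact ih _ _ _ (P.pop_length_le hq) (by linarith)

/-- The longest time that a busy server can take to become idle without arrivals: the transmission in
progress and one for each of the at most `M` requests of a queue. -/
noncomputable def clearingTime : ℝ := P.serviceTime + P.M * P.serviceTime

theorem advance_eq_idle_of_clearingTime_lt {x : P.State} (hx : P.Admissible x) {t : ℝ}
    (ht : P.clearingTime < t) : P.advance x.1 x.2 t = (P.emptyQueues, 0) :=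
  P.advance_eq_idle P.M _ _ _ (fun j => (x.1 j).length_le)
    (by have := hx.2.1; unfold clearingTime at ht; linarith)

/-- The state just after each arrival, as a random recursion: the inputs are the interarrival times
with the streams, the outputs are the queuing delays, and an interarrival time longer than
`clearingTime` resets the system, since the next request then finds the server idle. -/
noncomputable def resetSystem : ResetSystem P.State (ℝ × P.Stream) where
  κ := P.markLaw
  next p := P.arrive (P.advance p.1.1 p.1.2 p.2.1) p.2.2.1.1 p.2.2.1.2
  out p := P.delay (P.advance p.1.1 p.1.2 p.2.1) p.2.2.1.1 p.2.2.1.2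
  reset := {y | P.clearingTime < y.1}
  base := (P.emptyQueues, P.serviceTime)
  valid := {x | P.Admissible x}
  isProbabilityMeasure := inferInstance
  measurable_next := by
    have h : Measurable fun p : P.State × P.Stream => P.arrive p.1 p.2.1.1 p.2.1.2 :=
      measurable_from_prod_countable_left fun e => P.measurable_arrive e.1.1 e.1.2
    exact h.comp ((P.measurable_advance.comp
      (f := fun p : P.State × (ℝ × P.Stream) => (p.1, p.2.1)) (by fun_prop)).prodMk (by fun_prop))
  measurable_out := by
    have h : Measurable fun p : P.State × P.Stream => P.delay p.1 p.2.1.1 p.2.1.2 :=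
      measurable_from_prod_countable_left fun e => P.measurable_delay e.1.1 e.1.2
    exact h.comp ((P.measurable_advance.comp
      (f := fun p : P.State × (ℝ × P.Stream) => (p.1, p.2.1)) (by fun_prop)).prodMk (by fun_prop))
  measurableSet_reset := measurableSet_lt measurable_const measurable_fst
  measurableSet_valid := P.measurableSet_admissible
  base_mem := ⟨P.serviceTime_pos.le, le_rfl, fun h => absurd h P.serviceTime_pos.ne'⟩
  next_mem := by
    filter_upwards [P.ae_markLaw_nonneg] with y hy x hx
    exact P.admissible_arrive
      (P.admissible_advance hy P.M _ _ (fun j => (x.1 j).length_le) hx) _ _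
  next_of_reset x hx y hy := by
    simp [P.advance_eq_idle_of_clearingTime_lt hx hy, arrive]
  out_of_reset x hx y hy := by
    simp [P.advance_eq_idle_of_clearingTime_lt hx hy, delay]
  measure_reset := P.markLaw_gt_ne_zero (by
    have := P.serviceTime_pos
    unfold clearingTime
    positivity)

theorem isIIDLaw_marksLaw : IsIIDLaw P.resetSystem.κ P.marksLaw := ⟨inferInstance, P.map_marksLaw⟩

theorem stateBefore_eq_orbit (x₀ : P.State) (τ : P.Clocks) (k : ℕ) :
    P.stateBefore x₀ τ k = P.advance (P.resetSystem.orbit x₀ (P.mark τ) k).1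
      (P.resetSystem.orbit x₀ (P.mark τ) k).2 (P.mark τ k).1 := by
  induction k with
  | zero => rfl
  | succ k ih =>
    have h2 : (P.mark τ k).2 = P.arrivalStream τ k := by cases k <;> rfl
    have h : P.resetSystem.orbit x₀ (P.mark τ) (k + 1) =
        P.arrive (P.stateBefore x₀ τ k) (P.arrivalStream τ k).1.1 (P.arrivalStream τ k).1.2 := by
      rw [ih, ← h2]
      rfl
    rw [h]
    rfl

theorem D_eq_output (k : ℕ) (ω : P.State × P.Clocks) :
    P.D k ω = P.resetSystem.output k (ω.1, P.mark ω.2) := by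
  have h2 : (P.mark ω.2 k).2 = P.arrivalStream ω.2 k := by cases k <;> rfl
  rw [D, stateBefore_eq_orbit, ← h2]
  rfl

theorem measurePreserving_marks (ν : Measure P.State) [IsProbabilityMeasure ν] :
    MeasurePreserving (fun ω : P.State × P.Clocks => (ω.1, P.mark ω.2)) (P.law ν)
      (ν.prod P.marksLaw) :=
  (MeasurePreserving.id ν).prod ⟨P.measurable_mark, rfl⟩

theorem measurable_D (k : ℕ) : Measurable (P.D k) := by
  rw [funext (P.D_eq_output k)]
  exact (P.resetSystem.measurable_output k).comp
    (measurable_fst.prodMk (P.measurable_mark.comp measurable_snd))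

theorem map_D (ν : Measure P.State) [IsProbabilityMeasure ν] (k : ℕ) :
    (P.law ν).map (P.D k) = (ν.prod P.marksLaw).map (P.resetSystem.output k) := by
  rw [← (P.measurePreserving_marks ν).map_eq, Measure.map_map
    (P.resetSystem.measurable_output k) (P.measurePreserving_marks ν).measurable]
  exact congrArg (Measure.map · (P.law ν)) (funext (P.D_eq_output k))

theorem isStrictlyStationary_D :
    IsStrictlyStationary (P.law P.resetSystem.stationary) P.D := by
  have h := ResetSystem.isStrictlyStationary_output P.isIIDLaw_marksLaw
  have hφ := P.measurePreserving_marks P.resetSystem.stationary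
  have h1 := hφ.identDistrib_comp h.aemeasurable_fst
  have h2 := hφ.identDistrib_comp h.aemeasurable_snd
  have h3 := (h1.trans h).trans h2.symm
  have hD : P.D = fun k ω => P.resetSystem.output k (ω.1, P.mark ω.2) :=
    funext fun k => funext (P.D_eq_output k)
  rw [hD]
  exact h3

theorem map_D_stationary (k : ℕ) : (P.law P.resetSystem.stationary).map (P.D k) =
    (P.law P.resetSystem.stationary).map (P.D 0) := by
  induction k with
  | zero => rfl
  | succ k ih =>
    rw [← ih]
    exact (P.isStrictlyStationary_D.comp (measurable_pi_apply k)).map_eq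

end PCSM

theorem proposition3 (P : PCSM) :
    (∀ ν : Measure P.State, P.IsInitialLaw ν → IsAperiodicRegenerative (P.law ν) P.D) ∧
      ∃! π : Measure ℝ, P.IsStationaryDistribution π := by
  have hiid := P.isIIDLaw_marksLaw
  refine ⟨fun ν hν => ?_, (P.law P.resetSystem.stationary).map (P.D 0), ⟨P.resetSystem.stationary,
    ⟨inferInstance, P.resetSystem.ae_stationary_valid⟩, P.isStrictlyStationary_D,
    fun k => ⟨(P.measurable_D k).aemeasurable, P.map_D_stationary k⟩⟩, ?_⟩
  · have := hν.1
    have h := (ResetSystem.isAperiodicRegenerative_output hiid hν.2).comp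
      (P.measurePreserving_marks ν)
    have hD : P.D = fun k ω => P.resetSystem.output k (ω.1, P.mark ω.2) :=
      funext fun k => funext (P.D_eq_output k)
    rwa [hD]
  · rintro π ⟨ν, hν, -, hπ⟩
    have := hν.1
    have hst := P.resetSystem.ae_stationary_valid
    have h1 : ∀ k, (ν.prod P.marksLaw).map (P.resetSystem.output k) = π := fun k => by
      rw [← P.map_D ν k, (hπ k).map_eq]
    have h2 : ∀ k, (P.resetSystem.stationary.prod P.marksLaw).map (P.resetSystem.output k) =
        (P.law P.resetSystem.stationary).map (P.D 0) := fun k => by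
      rw [← P.map_D _ k, P.map_D_stationary]
    exact le_antisymm (ResetSystem.law_output_unique hiid hν.2 hst h1 h2)
      (ResetSystem.law_output_unique hiid hst hν.2 h2 h1)
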